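/- **Setting (shear data).** All manifolds, maps, vector fields and differential forms are smooth; manifolds are finite-dimensional, Hausdorff, second countable and without boundary. Let $M$ be a manifold with a vector field $X$, a two-form $F$, a closed one-form $\eta$ with $\eta(X)=0$ and $dF=\eta\wedge F$, and a nowhere vanishing function $a\in C^\infty(M)$. Let $\pi\colon P\to M$ be a fibre bundle with connected one-dimensional fibres, and let $\theta\in\Omega^1(P)$ be a one-form such that $\mathcal H=\ker\theta$ is complementary to $\ker\pi_*$ and $d\theta=\pi^*\eta\wedge\theta+\pi^*F$. Let $X'$ be the vector field on $P$ with $\pi_*X'=X$ and $\theta(X')=\pi^*a$ (that is, $X'=\widetilde X+(\pi^*a)Y$, where $\widetilde X$ is the horizontal lift of $X$ and $Y$ is the vertical field with $\theta(Y)=1$), and let $\xi'$ be the one-dimensional foliation of $P$ spanned by $X'$. Suppose that near each point $\xi'$ has a nowhere vanishing local section $A$ with $L_A\theta=0$. Suppose that the leaf space $S=P/\xi'$, the *shear* of $M$, is a manifold, so that the projection $\pi_S\colon P\to S$ is a surjective submersion whose fibres are the leaves of $\xi'$ (and $\ker(\pi_S)_*=\xi'$). Forms $\alpha\in\Omega^p(M)$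 and $\alpha_S\in\Omega^p(S)$ are *$\mathcal H$-related*, written $\alpha\sim_{\mathcal H}\alpha_S$, if $\pi^*\alpha$ and $\pi_S^*\alpha_S$ agree on $\Lambda^p\mathcal H$. Put $\nu=X\lrcorner F$ and $\gamma=a^{-1}(da+\nu)-\eta$. A form $\alpha\in\Omega^p(M)$ is *automorphic* if $L_X\alpha=\gamma\wedge(X\lrcorner\alpha)$, and $d_S\alpha:=d\alpha-a^{-1}F\wedge(X\lrcorner\alpha)$; here $X\lrcorner\alpha=0$ if $p=0$. **Statement.** For all $p\ge 0$: 1. a form $\alpha\in\Omega^p(M)$ is $\mathcal H$-related to some $\alpha_S\in\Omega^p(S)$ if and only if $\alpha$ is automorphic; 2. if $\alpha\sim_{\mathcal H}\alpha_S$, then $d_S\alpha\sim_{\mathcal H}d\alpha_S$; 3. the automorphic forms on $M$ form a differential algebra under $d_S$: they contain the constants and are closed under sums, real multiples, wedge products and $d_S$, and on them $d_S$ is linear, satisfies $d_S(\alpha\wedge\beta)=d_S\alpha\wedge\beta+(-1)^{\deg\alpha}\alpha\wedge d_S\beta$, and $d_S^2=0$. -/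

import Mathlib

open Set Function
open scoped Manifold ContDiff Topology

noncomputable section

namespace ShearConstruction

/-! ### Linear algebra of alternating forms on one vector space -/

section Linear

variable {E : Type*} [NormedAddCommGroup E] [NormedSpace ℝ E]

/-- The wedge product of two alternating forms `a`, `b` of degrees `p`, `q`, as an alternating form
of degree `r = p + q`:
`(a ∧ b)(v₁, …, v_r) = ∑ sign(σ) a(v_σ(1), …, v_σ(p)) b(v_σ(p+1), …, v_σ(r))`,
the sum running over the `(p, q)`-shuffles `σ`. -/
def wedgeAlt {p q r : ℕ} (h : p + q = r) (a : E [⋀^Fin p]→L[ℝ] ℝ) (b : E [⋀^Fin q]→L[ℝ] ℝ) :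
    E [⋀^Fin r]→L[ℝ] ℝ :=
  { ((LinearMap.mul' ℝ ℝ).compAlternatingMap
      (a.toAlternatingMap.domCoprod b.toAlternatingMap)).domDomCongr
        (finSumFinEquiv.trans (finCongr h)) with
    cont := by
      change Continuous fun v : Fin r → E => LinearMap.mul' ℝ ℝ
        ((a.toAlternatingMap.domCoprod b.toAlternatingMap)
          fun i => v ((finSumFinEquiv.trans (finCongr h)) i))
      simp only [AlternatingMap.domCoprod_apply, sum_apply, map_sum]
      refine continuous_finsetSum _ fun σ _ => ?_
      induction σ using Quotient.inductionOn' with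
      | h σ =>
        rw [AlternatingMap.domCoprod.summand_mk'']
        refine (Continuous.const_smul (M := ℤˣ) (Continuous.mul (M := ℝ) (a.cont.comp
          (continuous_pi fun i => continuous_apply (finCongr h (finSumFinEquiv (σ (Sum.inl i))))))
          (b.cont.comp (continuous_pi fun i =>
            continuous_apply (finCongr h (finSumFinEquiv (σ (Sum.inr i)))))))
          (Equiv.Perm.sign σ)).congr fun v => ?_
        rw [smul_apply, Units.smul_def, Units.smul_def, map_zsmul,
          MultilinearMap.domDomCongr_apply, MultilinearMap.domCoprod_apply, LinearMap.mul'_apply]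
        rfl }

/-- An alternating form of degree one, seen as a linear form. -/
def covector (a : E [⋀^Fin 1]→L[ℝ] ℝ) : E →L[ℝ] ℝ :=
  (ContinuousAlternatingMap.ofSubsingleton ℝ E ℝ (0 : Fin 1)).symm a

/-- The Lie derivative `L_V α` on a vector space, in coordinates:
`(L_V α)_y(v₁, …, v_p) = (D_y α · V(y))(v₁, …, v_p) + ∑ᵢ α_y(v₁, …, D_y V · vᵢ, …, v_p)`. -/
def lieDerivFlat {p : ℕ} (V : E → E) (α : E → E [⋀^Fin p]→L[ℝ] ℝ) (y : E) :
    E [⋀^Fin p]→L[ℝ] ℝ :=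
  fderiv ℝ α y (V y) +
    (α y).fderivCompContinuousLinearMap (ContinuousLinearMap.id ℝ E) (fderiv ℝ V y)

end Linear

/-! ### Vector fields and differential forms on manifolds

A manifold is a topological space `M` with a smooth atlas (`IsManifold 𝓘(ℝ, E) ∞ M`) of charts in a
finite-dimensional normed space `E`. -/

/-- Vector fields, not necessarily smooth. -/
abbrev VField (E : Type*) [NormedAddCommGroup E] [NormedSpace ℝ E]
    (M : Type*) [TopologicalSpace M] [ChartedSpace E M] :=
  (x : M) → TangentSpace 𝓘(ℝ, E) x

/-- Differential forms of degree `p`, not necessarily smooth: at each point `x` an alternating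
form on the tangent space `TangentSpace 𝓘(ℝ, E) x`, which is `E` by definition. -/
abbrev DForm (E : Type*) [NormedAddCommGroup E] [NormedSpace ℝ E] (M : Type*) (p : ℕ) :=
  M → E [⋀^Fin p]→L[ℝ] ℝ

section Manifold

variable {E : Type*} [NormedAddCommGroup E] [NormedSpace ℝ E]
  {M : Type*} [TopologicalSpace M] [ChartedSpace E M]
  {E' : Type*} [NormedAddCommGroup E'] [NormedSpace ℝ E']
  {N : Type*} [TopologicalSpace N] [ChartedSpace E' N]

/-- The vector field `X` is smooth on the set `U`. -/
def SmoothFieldOn [IsManifold 𝓘(ℝ, E) ∞ M] (X : VField E M) (U : Set M) : Prop :=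
  ContMDiffOn 𝓘(ℝ, E) 𝓘(ℝ, E).tangent ∞ (fun x => (X x : TangentBundle 𝓘(ℝ, E) M)) U

/-- The pull-back `f^* α` of a form under a map `f : M → N`. -/
def pullback {p : ℕ} (f : M → N) (α : DForm E' N p) : DForm E M p := fun x =>
  (α (f x)).compContinuousLinearMap (mfderiv 𝓘(ℝ, E) 𝓘(ℝ, E') f x : E →L[ℝ] E')

/-- The expression of a form in the preferred chart around `x₀`. -/
def chartForm {p : ℕ} (α : DForm E M p) (x₀ : M) : E → E [⋀^Fin p]→L[ℝ] ℝ :=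
  pullback (extChartAt 𝓘(ℝ, E) x₀).symm α

/-- The expression of a vector field in the preferred chart around `x₀`. -/
def chartField (X : VField E M) (x₀ : M) : E → E :=
  VectorField.mpullback 𝓘(ℝ, E) 𝓘(ℝ, E) (extChartAt 𝓘(ℝ, E) x₀).symm X

/-- Smooth forms: the coefficients in the charts are smooth. -/
def SmoothForm {p : ℕ} (α : DForm E M p) : Prop :=
  ∀ x₀ : M, ContDiffOn ℝ ∞ (chartForm α x₀) (extChartAt 𝓘(ℝ, E) x₀).target

/-- The exterior derivative, computed at each point in the preferred chart around it. -/
def extD {p : ℕ} (α : DForm E M p) : DForm E M (p + 1) := fun x =>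
  pullback (extChartAt 𝓘(ℝ, E) x) (extDeriv (chartForm α x)) x

/-- The Lie derivative `L_X α`, computed at each point in the preferred chart around it. -/
def lieD {p : ℕ} (X : VField E M) (α : DForm E M p) : DForm E M p := fun x =>
  pullback (extChartAt 𝓘(ℝ, E) x) (lieDerivFlat (chartField X x) (chartForm α x)) x

/-- The wedge product of forms of degrees `p` and `q`, of degree `r = p + q`. -/
def wedge {p q r : ℕ} (h : p + q = r) (α : DForm E M p) (β : DForm E M q) : DForm E M r :=
  fun x => wedgeAlt h (α x) (β x)

/-- The interior product `X ⌟ α` of a form of positive degree: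
`(X ⌟ α)(v₁, …, v_p) = α(X, v₁, …, v_p)`. -/
def interior {p : ℕ} (X : VField E M) (α : DForm E M (p + 1)) : DForm E M p :=
  fun x => (α x).curryLeft (X x)

/-- A function as a form of degree zero. -/
def ofFun (E : Type*) [NormedAddCommGroup E] [NormedSpace ℝ E] {M : Type*} (f : M → ℝ) :
    DForm E M 0 :=
  fun x => ContinuousAlternatingMap.constOfIsEmpty ℝ E (Fin 0) (f x)

/-- The product of a function and a form. -/
def fmul {p : ℕ} (f : M → ℝ) (α : DForm E M p) : DForm E M p := fun x => f x • α x

/-- `p` and `q` lie on the same leaf of the foliation tangent to the nowhere vanishing vector field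
`Z`: some integral curve of `Z` passes through both of them. -/
def SameLeaf (Z : VField E M) (p q : M) : Prop :=
  ∃ (c : ℝ → M) (s t : ℝ), IsMIntegralCurveOn c Z (Ioo s t) ∧ p ∈ c '' Ioo s t ∧ q ∈ c '' Ioo s t

/-- `π : M → N` is a smooth fibre bundle with typical fibre `L`. -/
def IsSmoothFibreBundle {EL : Type*} [NormedAddCommGroup EL] [NormedSpace ℝ EL]
    (L : Type*) [TopologicalSpace L] [ChartedSpace EL L] (π : M → N) : Prop :=
  ∀ x : N, ∃ e : Bundle.Trivialization L π, x ∈ e.baseSet ∧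
    ContMDiffOn 𝓘(ℝ, E) (𝓘(ℝ, E').prod 𝓘(ℝ, EL)) ∞ e e.source ∧
    ContMDiffOn (𝓘(ℝ, E').prod 𝓘(ℝ, EL)) 𝓘(ℝ, E) ∞ e.toOpenPartialHomeomorph.symm e.target

end Manifold

/-! ### The shear construction -/

section Shear

variable {E : Type*} [NormedAddCommGroup E] [NormedSpace ℝ E]
  {M : Type*} [TopologicalSpace M] [ChartedSpace E M]
  {EP : Type*} [NormedAddCommGroup EP] [NormedSpace ℝ EP]
  {P : Type*} [TopologicalSpace P] [ChartedSpace EP P]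
  {ES : Type*} [NormedAddCommGroup ES] [NormedSpace ℝ ES]
  {S : Type*} [TopologicalSpace S] [ChartedSpace ES S]

/-- The horizontal space `𝓗 = ker θ` at a point. -/
def horizontal (θ : DForm EP P 1) (p : P) : Submodule ℝ EP := LinearMap.ker (covector (θ p)).toLinearMap

/-- The kernel of the differential of a map, the tangent space of its fibre. -/
def vertical (f : P → M) (p : P) : Submodule ℝ EP :=
  LinearMap.ker (mfderiv 𝓘(ℝ, EP) 𝓘(ℝ, E) f p).toLinearMap

/-- The data of a shear: `S` is the shear of `M`.

* `M` carries a vector field `X`, a two-form `F`, a closed one-form `η` with `η(X) = 0` and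
  `dF = η ∧ F`, and a nowhere vanishing function `a`;
* `π : P → M` is a fibre bundle with typical fibre `L`, `θ` is a one-form on `P` whose kernel is
  transverse to the fibres, and `dθ = π^* η ∧ θ + π^* F`;
* `ξ'` is the foliation of `P` spanned by the vector field `X'`. This `X'` projects to `X` and has
  `θ(X') = π^* a`; in other words `X' = X̃ + (π^* a) Y`, with `X̃` the `θ`-horizontal lift of `X`
  and `Y` the vertical field with `θ(Y) = 1`. Locally `ξ'` has generating sections which
  preserve `θ`;
* `πS : P → S` is the projection to the leaf space of `ξ'`: a surjective submersion whose fibres are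
  the leaves of `ξ'`. -/
structure IsShear [IsManifold 𝓘(ℝ, E) ∞ M] [IsManifold 𝓘(ℝ, EP) ∞ P]
    {EL : Type*} [NormedAddCommGroup EL] [NormedSpace ℝ EL]
    (L : Type*) [TopologicalSpace L] [ChartedSpace EL L]
    (X : VField E M) (F : DForm E M 2) (η : DForm E M 1) (a : M → ℝ)
    (π : P → M) (θ : DForm EP P 1) (X' : VField EP P) (πS : P → S) : Prop where
  smooth_X : SmoothFieldOn X univ
  smooth_F : SmoothForm F
  smooth_η : SmoothForm η
  closed_η : extD η = 0
  η_X : ∀ x, covector (η x) (X x) = 0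
  d_F : extD F = wedge (by norm_num : 1 + 2 = 3) η F
  smooth_a : ContMDiff 𝓘(ℝ, E) 𝓘(ℝ, ℝ) ∞ a
  a_ne_zero : ∀ x, a x ≠ 0
  bundle : IsSmoothFibreBundle (E := EP) (E' := E) (EL := EL) L π
  smooth_θ : SmoothForm θ
  transverse : ∀ p, IsCompl (horizontal θ p) (vertical (E := E) π p)
  d_θ : extD θ = wedge (by norm_num : 1 + 1 = 2) (pullback π η) θ + pullback π F
  smooth_X' : SmoothFieldOn X' univ
  lift_X : ∀ p, mfderiv 𝓘(ℝ, EP) 𝓘(ℝ, E) π p (X' p) = X (π p)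
  θ_X' : ∀ p, covector (θ p) (X' p) = a (π p)
  preserving : ∀ p : P, ∃ U : Set P, IsOpen U ∧ p ∈ U ∧ ∃ A : VField EP P, SmoothFieldOn A U ∧
    ∀ q ∈ U, (∃ c : ℝ, c ≠ 0 ∧ A q = c • X' q) ∧ lieD A θ q = 0
  submersion : Manifold.IsSubmersion 𝓘(ℝ, EP) 𝓘(ℝ, ES) ∞ πS
  surjective : Surjective πS
  vertical_πS : ∀ p, vertical (E := ES) πS p = Submodule.span ℝ (M := EP) {X' p}
  leaves : ∀ p q, πS p = πS q ↔ SameLeaf X' p q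

/-- `α` on `M` and `αS` on `S` are `𝓗`-related: `π^* α` and `πS^* αS` agree on `Λ^k 𝓗`. -/
def HRelated {k : ℕ} (π : P → M) (θ : DForm EP P 1) (πS : P → S)
    (α : DForm E M k) (αS : DForm ES S k) : Prop :=
  ∀ (p : P) (v : Fin k → EP), (∀ i, v i ∈ horizontal θ p) →
    pullback π α p v = pullback πS αS p v

/-- The one-form `γ = a⁻¹ (da + ν) - η`, where `ν = X ⌟ F`. -/
def gammaForm (X : VField E M) (F : DForm E M 2) (η : DForm E M 1) (a : M → ℝ) : DForm E M 1 :=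
  fmul a⁻¹ (extD (ofFun E a) + interior X F) - η

/-- The automorphic condition `L_X α = γ ∧ (X ⌟ α)`. For a function, `X ⌟ α = 0`. -/
def Automorphic (X : VField E M) (F : DForm E M 2) (η : DForm E M 1) (a : M → ℝ) :
    {k : ℕ} → DForm E M k → Prop
  | 0, α => lieD X α = 0
  | k + 1, α => lieD X α = wedge (Nat.add_comm 1 k) (gammaForm X F η a) (interior X α)

/-- The shear differential `d_S α = dα - a⁻¹ F ∧ (X ⌟ α)`. For a function, `X ⌟ α = 0`. -/
def shearD (X : VField E M) (F : DForm E M 2) (a : M → ℝ) :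
    {k : ℕ} → DForm E M k → DForm E M (k + 1)
  | 0, α => extD α
  | k + 1, α => extD α - fmul a⁻¹ (wedge (Nat.add_comm 2 k) F (interior X α))

/-- The forms in the sets `A k` (of degree `k`) are a differential algebra under `D`: they contain
the constants, they are closed under sums, real multiples, wedge products and `D`, and on them `D`
is a linear antiderivation of square zero. -/
structure IsDifferentialAlgebra (A : (k : ℕ) → Set (DForm E M k))
    (D : {k : ℕ} → DForm E M k → DForm E M (k + 1)) : Prop where
  const_mem : ∀ c : ℝ, ofFun E (fun _ : M => c) ∈ A 0
  add_mem : ∀ {k : ℕ} {α β : DForm E M k}, α ∈ A k → β ∈ A k → α + β ∈ A k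
  smul_mem : ∀ {k : ℕ} (c : ℝ) {α : DForm E M k}, α ∈ A k → c • α ∈ A k
  zero_mem : ∀ k : ℕ, 0 ∈ A k
  wedge_mem : ∀ {j k l : ℕ} (h : j + k = l) {α : DForm E M j} {β : DForm E M k},
    α ∈ A j → β ∈ A k → wedge h α β ∈ A l
  D_mem : ∀ {k : ℕ} {α : DForm E M k}, α ∈ A k → D α ∈ A (k + 1)
  D_add : ∀ {k : ℕ} {α β : DForm E M k}, α ∈ A k → β ∈ A k → D (α + β) = D α + D β
  D_smul : ∀ {k : ℕ} (c : ℝ) {α : DForm E M k}, α ∈ A k → D (c • α) = c • D α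
  D_D : ∀ {k : ℕ} {α : DForm E M k}, α ∈ A k → D (D α) = 0
  D_wedge : ∀ {j k l : ℕ} (h : j + k = l) {α : DForm E M j} {β : DForm E M k},
    α ∈ A j → β ∈ A k →
      D (wedge h α β) = wedge (by omega : (j + 1) + k = l + 1) (D α) β +
        (-1 : ℝ) ^ j • wedge (by omega : j + (k + 1) = l + 1) α (D β)

end Shear

end ShearConstruction

end

/-! Everything is compared on `P`. Since `θ(X') = π^* a` has no zeros, the tangent space of `P` is
the sum of `ker θ` and the line of `X'`. Hence a form `α` on `M` has exactly one lift to `P` that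
agrees with `π^* α` on horizontal vectors and is annihilated by `X'`. With `ζ = a⁻¹ (X ⌟ α)` it is
`π^* α - θ ∧ π^* ζ` (`shearLift`). Pull-backs from `S` are annihilated by `X'`, so `α` is related to
`αS` exactly when `πS^* αS` is this lift (`hRelated_iff_pullback_eq`).

The lift is therefore to be pulled back from `S`. As the leaves are connected, this holds once `X'`
annihilates both the lift and its differential (`exists_eq_pullback_of_isSubmersion`). By the
Leibniz rule the differential is `π^* dα - dθ ∧ π^* ζ + θ ∧ π^* dζ`, and `dθ = π^* η ∧ θ + π^* F`.
On horizontal vectors it equals `π^*` of the shear differential (`hrestrict_extD_shearLift`). Its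
contraction with `X'`, on horizontal vectors, is `π^* (L_X α - γ ∧ (X ⌟ α))`
(`hrestrict_curryLeft_extD_shearLift`). The second identity gives the correspondence with
automorphic forms, the first the rule for differentials.

A form on `M` is determined by any form on `S` related to it (`eq_of_hRelated`), because horizontal
vectors project onto all tangent vectors of `M`. The differential algebra structure is then carried
over from `S`.

The rest of the file develops the calculus needed for this: the wedge product, the exterior
derivative and Cartan's formula, first on vector spaces, then in charts. -/

open Set Function
open scoped Manifold ContDiff Topology

noncomputable section

namespace ShearConstruction

/-! ### Contraction of a wedge product with a vector -/

section WedgeAlgebra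

variable {E : Type*} [NormedAddCommGroup E] [NormedSpace ℝ E]

/-- Expansion of an antisymmetrised sum according to the position of the first argument. -/
theorem sum_sign_mul_comp_perm_succ {V : Type*} {n : ℕ} (T : (Fin (n + 1) → V) → ℝ)
    (v : Fin (n + 1) → V) :
    ∑ σ : Equiv.Perm (Fin (n + 1)), ((Equiv.Perm.sign σ : ℤ) : ℝ) * T (v ∘ σ) =
      ∑ j : Fin (n + 1), (-1 : ℝ) ^ (j : ℕ) * ∑ e : Equiv.Perm (Fin n),
        ((Equiv.Perm.sign e : ℤ) : ℝ) * T (j.insertNth (v 0) (Fin.tail v ∘ e)) := by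
  -- A permutation is determined by the index `j` that it sends to `0` and by its effect `e` on the
  -- others; `cycleRange` moves `j` to `0` and accounts for the sign `(-1) ^ j`.
  have hbij : Bijective fun x : Fin (n + 1) × Equiv.Perm (Fin n) =>
      Equiv.Perm.decomposeFin.symm (0, x.2) * x.1.cycleRange := by
    rw [Fintype.bijective_iff_injective_and_card]
    refine ⟨?_, by simp [Fintype.card_perm, Nat.factorial_succ]⟩
    rintro ⟨j, e⟩ ⟨j', e'⟩ h
    have hj : j = j' := by
      apply (Equiv.Perm.decomposeFin.symm (0, e) * j.cycleRange).injective
      trans (0 : Fin (n + 1))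
      · simp
      · simp only at h
        rw [h]
        simp
    subst hj
    simpa using h
  simp only [Finset.mul_sum]
  rw [← Fintype.sum_prod_type']
  refine (Fintype.sum_bijective _ hbij _ _ ?_).symm
  rintro ⟨j, e⟩
  have hv : v ∘ ⇑(Equiv.Perm.decomposeFin.symm (0, e)) = Fin.cons (v 0) (Fin.tail v ∘ e) := by
    ext k
    cases k using Fin.cases <;> simp [Fin.tail]
  simp only [Equiv.Perm.coe_mul, ← comp_assoc, hv, Fin.cons_comp_cycleRange, Equiv.Perm.sign_mul,
    Equiv.Perm.decomposeFin.symm_sign, Fin.sign_cycleRange]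
  push_cast
  simp
  ring

/-- The inclusion of the first block of indices. -/
def leftIdx {p q r : ℕ} (h : p + q = r) (i : Fin p) : Fin r := Fin.cast h (Fin.castAdd q i)

/-- The inclusion of the second block of indices. -/
def rightIdx {p q r : ℕ} (h : p + q = r) (i : Fin q) : Fin r := Fin.cast h (Fin.natAdd p i)

/-- Permuting within each block repeats every shuffle `p! q!` times. A sum over all permutations is
easier to reindex than one over shuffle classes. -/
theorem factorial_mul_wedgeAlt_apply {p q r : ℕ} (h : p + q = r) (a : E [⋀^Fin p]→L[ℝ] ℝ)
    (b : E [⋀^Fin q]→L[ℝ] ℝ) (v : Fin r → E) :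
    ((p.factorial * q.factorial : ℕ) : ℝ) * wedgeAlt h a b v =
      ∑ σ : Equiv.Perm (Fin r), ((Equiv.Perm.sign σ : ℤ) : ℝ) *
        (a ((v ∘ σ) ∘ leftIdx h) * b ((v ∘ σ) ∘ rightIdx h)) := by
  set e := finSumFinEquiv.trans (finCongr h)
  have h1 : wedgeAlt h a b v = LinearMap.mul' ℝ ℝ
      ((a.toAlternatingMap.domCoprod b.toAlternatingMap) (v ∘ e)) := rfl
  have h2 := congrArg (fun f => LinearMap.mul' ℝ ℝ (f (v ∘ e)))
    (MultilinearMap.domCoprod_alternization_eq a.toAlternatingMap b.toAlternatingMap)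
  simp only [Fintype.card_fin, AlternatingMap.smul_apply] at h2
  rw [map_nsmul, ← h1, nsmul_eq_mul] at h2
  rw [← h2, MultilinearMap.alternatization_apply, map_sum]
  refine Fintype.sum_equiv e.permCongr _ _ fun σ => ?_
  rw [Equiv.Perm.sign_permCongr, Units.smul_def, map_zsmul,
    MultilinearMap.domDomCongr_apply, MultilinearMap.domCoprod_apply, LinearMap.mul'_apply,
    zsmul_eq_mul]
  congr 2
  · change a _ = a _
    congr 1
    ext i
    simp [leftIdx, Equiv.permCongr_apply, e]
  · change b _ = b _
    congr 1
    ext i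
    simp [rightIdx, Equiv.permCongr_apply, e]

/-- The distinguished vector lands in one of the two blocks. This lemma and the next three separate
the blocks, which yields the two terms of the antiderivation rule. -/
theorem insertNth_comp_leftIdx {V : Type*} {p q r : ℕ} (h : p + 1 + q = r + 1) (i : Fin (p + 1))
    (x : V) (w : Fin r → V) :
    ((leftIdx h i).insertNth x w : Fin (r + 1) → V) ∘ leftIdx h =
      i.insertNth x (w ∘ leftIdx (show p + q = r by omega)) := by
  ext k
  cases k using Fin.succAboveCases i with
  | x => simp
  | p k => 
    have : leftIdx h (i.succAbove k) =
        (leftIdx h i).succAbove (leftIdx (show p + q = r by omega) k) := by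
      ext
      simp only [leftIdx, Fin.succAbove, Fin.lt_def]
      split_ifs <;> simp_all <;> omega
    simp [this]

theorem insertNth_leftIdx_comp_rightIdx {V : Type*} {p q r : ℕ} (h : p + 1 + q = r + 1)
    (i : Fin (p + 1)) (x : V) (w : Fin r → V) :
    ((leftIdx h i).insertNth x w : Fin (r + 1) → V) ∘ rightIdx h =
      w ∘ rightIdx (show p + q = r by omega) := by
  ext k
  have : rightIdx h k = (leftIdx h i).succAbove (rightIdx (show p + q = r by omega) k) := by
    ext
    simp only [leftIdx, rightIdx, Fin.succAbove, Fin.lt_def]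
    split_ifs <;> simp_all <;> omega
  simp [this]

theorem insertNth_comp_rightIdx {V : Type*} {p q r : ℕ} (h : p + (q + 1) = r + 1) (i : Fin (q + 1))
    (x : V) (w : Fin r → V) :
    ((rightIdx h i).insertNth x w : Fin (r + 1) → V) ∘ rightIdx h =
      i.insertNth x (w ∘ rightIdx (show p + q = r by omega)) := by
  ext k
  cases k using Fin.succAboveCases i with
  | x => simp
  | p k => 
    have : rightIdx h (i.succAbove k) =
        (rightIdx h i).succAbove (rightIdx (show p + q = r by omega) k) := by
      ext
      simp only [rightIdx, Fin.succAbove, Fin.lt_def]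
      split_ifs <;> simp_all <;> omega
    simp [this]

theorem insertNth_rightIdx_comp_leftIdx {V : Type*} {p q r : ℕ} (h : p + (q + 1) = r + 1)
    (i : Fin (q + 1)) (x : V) (w : Fin r → V) :
    ((rightIdx h i).insertNth x w : Fin (r + 1) → V) ∘ leftIdx h =
      w ∘ leftIdx (show p + q = r by omega) := by
  ext k
  have : leftIdx h k = (rightIdx h i).succAbove (leftIdx (show p + q = r by omega) k) := by
    ext
    simp only [leftIdx, rightIdx, Fin.succAbove, Fin.lt_def]
    split_ifs <;> simp_all <;> omega
  simp [this]

theorem sum_eq_sum_leftIdx_add_sum_rightIdx {p q r : ℕ} (h : p + q = r) (f : Fin r → ℝ) :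
    ∑ j, f j = ∑ i, f (leftIdx h i) + ∑ i, f (rightIdx h i) := by
  subst h
  exact Fin.sum_univ_add f

/-- The part of the interior product of a wedge product which comes from the left factor. -/
def curryWedgeLeft : {p q r : ℕ} → p + q = r + 1 → (E [⋀^Fin p]→L[ℝ] ℝ) →
    (E [⋀^Fin q]→L[ℝ] ℝ) → E → E [⋀^Fin r]→L[ℝ] ℝ
  | 0, _, _, _, _, _, _ => 0
  | _ + 1, _, _, h, a, b, x => wedgeAlt (by omega) (a.curryLeft x) b

/-- The part of the interior product of a wedge product which comes from the right factor. -/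
def curryWedgeRight : {p q r : ℕ} → p + q = r + 1 → (E [⋀^Fin p]→L[ℝ] ℝ) →
    (E [⋀^Fin q]→L[ℝ] ℝ) → E → E [⋀^Fin r]→L[ℝ] ℝ
  | _, 0, _, _, _, _, _ => 0
  | _, _ + 1, _, h, a, b, x => wedgeAlt (by omega) a (b.curryLeft x)

/-- The interior product is an antiderivation. -/
theorem curryLeft_wedgeAlt {p q r : ℕ} (h : p + q = r + 1) (a : E [⋀^Fin p]→L[ℝ] ℝ)
    (b : E [⋀^Fin q]→L[ℝ] ℝ) (x : E) :
    (wedgeAlt h a b).curryLeft x =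
      curryWedgeLeft h a b x + (-1 : ℝ) ^ p • curryWedgeRight h a b x := by
  ext w
  have hf : ((p.factorial * q.factorial : ℕ) : ℝ) ≠ 0 := by positivity
  refine mul_left_cancel₀ hf ?_
  rw [ContinuousAlternatingMap.curryLeft_apply_apply, factorial_mul_wedgeAlt_apply,
    sum_sign_mul_comp_perm_succ (fun u => a (u ∘ leftIdx h) * b (u ∘ rightIdx h)),
    sum_eq_sum_leftIdx_add_sum_rightIdx h, ContinuousAlternatingMap.add_apply, mul_add]
  congr 1
  · cases p with
    | zero => simp [curryWedgeLeft]
    | succ p =>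
      simp only [insertNth_comp_leftIdx, insertNth_leftIdx_comp_rightIdx, curryWedgeLeft]
      rw [Nat.factorial_succ, mul_assoc, Nat.cast_mul, mul_assoc, factorial_mul_wedgeAlt_apply]
      -- Moving `x` to the front of its block cancels the sign `(-1) ^ i`, so the `p + 1` positions
      -- contribute equally and supply the factor `p + 1` of `(p + 1)!`.
      trans ∑ _i : Fin (p + 1), ∑ σ : Equiv.Perm (Fin r), ((Equiv.Perm.sign σ : ℤ) : ℝ) *
        (a.curryLeft x ((w ∘ σ) ∘ leftIdx (show p + q = r by omega)) *
          b ((w ∘ σ) ∘ rightIdx (show p + q = r by omega)))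
      · refine Finset.sum_congr rfl fun i _ => ?_
        rw [Finset.mul_sum]
        refine Finset.sum_congr rfl fun σ _ => ?_
        have := a.neg_one_pow_smul_map_insertNth i x
          ((w ∘ σ) ∘ leftIdx (show p + q = r by omega))
        simp only [zsmul_eq_mul] at this
        push_cast at this
        rw [ContinuousAlternatingMap.curryLeft_apply_apply, ← this]
        simp [leftIdx]
        ring
      · simp
  · cases q with
    | zero => simp [curryWedgeRight]
    | succ q =>
      simp only [insertNth_comp_rightIdx, insertNth_rightIdx_comp_leftIdx, curryWedgeRight]
      rw [Nat.factorial_succ, mul_left_comm, Nat.cast_mul, mul_assoc,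
        ContinuousAlternatingMap.smul_apply, smul_eq_mul, mul_left_comm _ ((-1 : ℝ) ^ p),
        factorial_mul_wedgeAlt_apply]
      -- Here the overall position is `p + i`, and after the `i` part of the sign is cancelled `(-1)
      -- ^ p` remains.
      trans ∑ _i : Fin (q + 1), (-1 : ℝ) ^ p * ∑ σ : Equiv.Perm (Fin r),
        ((Equiv.Perm.sign σ : ℤ) : ℝ) *
        (a ((w ∘ σ) ∘ leftIdx (show p + q = r by omega)) *
          b.curryLeft x ((w ∘ σ) ∘ rightIdx (show p + q = r by omega)))
      · refine Finset.sum_congr rfl fun i _ => ?_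
        rw [Finset.mul_sum, Finset.mul_sum]
        refine Finset.sum_congr rfl fun σ _ => ?_
        have := b.neg_one_pow_smul_map_insertNth i x
          ((w ∘ σ) ∘ rightIdx (show p + q = r by omega))
        simp only [zsmul_eq_mul] at this
        push_cast at this
        rw [ContinuousAlternatingMap.curryLeft_apply_apply, ← this]
        simp [rightIdx, pow_add]
        ring
      · simp

end WedgeAlgebra

/-! ### Bilinearity of the wedge product and contraction of alternatisations -/

section WedgeBilinear

variable {E : Type*} [NormedAddCommGroup E] [NormedSpace ℝ E]
  {E' : Type*} [NormedAddCommGroup E'] [NormedSpace ℝ E']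

/-- Equality of forms can be tested on wedge expansions. -/
theorem eq_wedgeAlt_of_factorial_mul_eq {p q r : ℕ} (h : p + q = r) {a : E [⋀^Fin p]→L[ℝ] ℝ}
    {b : E [⋀^Fin q]→L[ℝ] ℝ} {c : E [⋀^Fin r]→L[ℝ] ℝ}
    (hc : ∀ v, ((p.factorial * q.factorial : ℕ) : ℝ) * c v =
      ∑ σ : Equiv.Perm (Fin r), ((Equiv.Perm.sign σ : ℤ) : ℝ) *
        (a ((v ∘ σ) ∘ leftIdx h) * b ((v ∘ σ) ∘ rightIdx h))) :
    c = wedgeAlt h a b := by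
  ext v
  have hf : ((p.factorial * q.factorial : ℕ) : ℝ) ≠ 0 := by positivity
  exact mul_left_cancel₀ hf ((hc v).trans (factorial_mul_wedgeAlt_apply h a b v).symm)

theorem wedgeAlt_add_left {p q r : ℕ} (h : p + q = r) (a a' : E [⋀^Fin p]→L[ℝ] ℝ)
    (b : E [⋀^Fin q]→L[ℝ] ℝ) : wedgeAlt h (a + a') b = wedgeAlt h a b + wedgeAlt h a' b := by
  refine (eq_wedgeAlt_of_factorial_mul_eq h fun v => ?_).symm
  simp only [ContinuousAlternatingMap.add_apply, mul_add, add_mul, factorial_mul_wedgeAlt_apply,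
    Finset.sum_add_distrib]

theorem wedgeAlt_add_right {p q r : ℕ} (h : p + q = r) (a : E [⋀^Fin p]→L[ℝ] ℝ)
    (b b' : E [⋀^Fin q]→L[ℝ] ℝ) : wedgeAlt h a (b + b') = wedgeAlt h a b + wedgeAlt h a b' := by
  refine (eq_wedgeAlt_of_factorial_mul_eq h fun v => ?_).symm
  simp only [ContinuousAlternatingMap.add_apply, mul_add, factorial_mul_wedgeAlt_apply,
    Finset.sum_add_distrib]

theorem wedgeAlt_smul_left {p q r : ℕ} (h : p + q = r) (c : ℝ) (a : E [⋀^Fin p]→L[ℝ] ℝ)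
    (b : E [⋀^Fin q]→L[ℝ] ℝ) : wedgeAlt h (c • a) b = c • wedgeAlt h a b := by
  refine (eq_wedgeAlt_of_factorial_mul_eq h fun v => ?_).symm
  rw [ContinuousAlternatingMap.smul_apply, smul_eq_mul, mul_left_comm,
    factorial_mul_wedgeAlt_apply, Finset.mul_sum]
  refine Finset.sum_congr rfl fun σ _ => ?_
  rw [ContinuousAlternatingMap.smul_apply, smul_eq_mul]
  ring

theorem wedgeAlt_smul_right {p q r : ℕ} (h : p + q = r) (c : ℝ) (a : E [⋀^Fin p]→L[ℝ] ℝ)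
    (b : E [⋀^Fin q]→L[ℝ] ℝ) : wedgeAlt h a (c • b) = c • wedgeAlt h a b := by
  refine (eq_wedgeAlt_of_factorial_mul_eq h fun v => ?_).symm
  rw [ContinuousAlternatingMap.smul_apply, smul_eq_mul, mul_left_comm,
    factorial_mul_wedgeAlt_apply, Finset.mul_sum]
  refine Finset.sum_congr rfl fun σ _ => ?_
  rw [ContinuousAlternatingMap.smul_apply, smul_eq_mul]
  ring

/-- The wedge product as a bilinear map. -/
def wedgeBilin (E : Type*) [NormedAddCommGroup E] [NormedSpace ℝ E] {p q r : ℕ} (h : p + q = r) :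
    (E [⋀^Fin p]→L[ℝ] ℝ) →ₗ[ℝ] (E [⋀^Fin q]→L[ℝ] ℝ) →ₗ[ℝ] (E [⋀^Fin r]→L[ℝ] ℝ) :=
  LinearMap.mk₂ ℝ (wedgeAlt h) (wedgeAlt_add_left h) (wedgeAlt_smul_left h) (wedgeAlt_add_right h)
    fun c a b => wedgeAlt_smul_right h c a b

theorem wedgeAlt_zero_left {p q r : ℕ} (h : p + q = r) (b : E [⋀^Fin q]→L[ℝ] ℝ) :
    wedgeAlt h 0 b = 0 :=
  (wedgeBilin E h).map_zero₂ b

theorem wedgeAlt_zero_right {p q r : ℕ} (h : p + q = r) (a : E [⋀^Fin p]→L[ℝ] ℝ) :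
    wedgeAlt h a 0 = 0 :=
  map_zero (wedgeBilin E h a)

theorem wedgeAlt_sub_left {p q r : ℕ} (h : p + q = r) (a a' : E [⋀^Fin p]→L[ℝ] ℝ)
    (b : E [⋀^Fin q]→L[ℝ] ℝ) : wedgeAlt h (a - a') b = wedgeAlt h a b - wedgeAlt h a' b :=
  (wedgeBilin E h).map_sub₂ a a' b

theorem wedgeAlt_sub_right {p q r : ℕ} (h : p + q = r) (a : E [⋀^Fin p]→L[ℝ] ℝ)
    (b b' : E [⋀^Fin q]→L[ℝ] ℝ) : wedgeAlt h a (b - b') = wedgeAlt h a b - wedgeAlt h a b' :=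
  map_sub (wedgeBilin E h a) b b'

/-- Forgetting continuity embeds these forms in the multilinear maps. The point is that linear maps
out of the space are then automatically continuous, the wedge product included. -/
instance finiteDimensional_continuousAlternatingMap [FiniteDimensional ℝ E] (p : ℕ) :
    FiniteDimensional ℝ (E [⋀^Fin p]→L[ℝ] ℝ) := by
  let f : (E [⋀^Fin p]→L[ℝ] ℝ) →ₗ[ℝ] MultilinearMap ℝ (fun _ : Fin p => E) ℝ :=
    { toFun := fun a => a.toMultilinearMap
      map_add' := fun _ _ => rfl
      map_smul' := fun _ _ => rfl }
  exact FiniteDimensional.of_injective f fun a b hab => by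
    ext v
    exact congrArg (fun g => g v) hab

/-- The wedge product as a continuous bilinear map. -/
def wedgeCLM (E : Type*) [NormedAddCommGroup E] [NormedSpace ℝ E] [FiniteDimensional ℝ E]
    {p q r : ℕ} (h : p + q = r) :
    (E [⋀^Fin p]→L[ℝ] ℝ) →L[ℝ] (E [⋀^Fin q]→L[ℝ] ℝ) →L[ℝ] (E [⋀^Fin r]→L[ℝ] ℝ) :=
  LinearMap.toContinuousLinearMap
    { toFun := fun a => LinearMap.toContinuousLinearMap (wedgeBilin E h a)
      map_add' := fun a a' => by
        ext1 b
        exact wedgeAlt_add_left h a a' b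
      map_smul' := fun c a => by
        ext1 b
        exact wedgeAlt_smul_left h c a b }

@[simp]
theorem wedgeCLM_apply [FiniteDimensional ℝ E] {p q r : ℕ} (h : p + q = r)
    (a : E [⋀^Fin p]→L[ℝ] ℝ) (b : E [⋀^Fin q]→L[ℝ] ℝ) : wedgeCLM E h a b = wedgeAlt h a b := rfl

theorem wedgeAlt_compContinuousLinearMap {p q r : ℕ} (h : p + q = r) (a : E [⋀^Fin p]→L[ℝ] ℝ)
    (b : E [⋀^Fin q]→L[ℝ] ℝ) (f : E' →L[ℝ] E) :
    (wedgeAlt h a b).compContinuousLinearMap f =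
      wedgeAlt h (a.compContinuousLinearMap f) (b.compContinuousLinearMap f) := by
  refine eq_wedgeAlt_of_factorial_mul_eq h fun v => ?_
  simp only [ContinuousAlternatingMap.compContinuousLinearMap_apply, factorial_mul_wedgeAlt_apply]
  rfl

/-- Antisymmetrising `b`, which is already alternating, repeats one term `q!` times. -/
theorem wedgeAlt_degree_zero_left {q : ℕ} (h : 0 + q = q) (a : E [⋀^Fin 0]→L[ℝ] ℝ)
    (b : E [⋀^Fin q]→L[ℝ] ℝ) : wedgeAlt h a b = a 0 • b := by
  refine (eq_wedgeAlt_of_factorial_mul_eq h fun v => ?_).symm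
  have hr : rightIdx h = id := by
    ext i
    simp [rightIdx]
  simp only [hr, comp_id, Nat.factorial_zero, one_mul, ContinuousAlternatingMap.smul_apply,
    smul_eq_mul]
  have ha (w : Fin 0 → E) : a w = a 0 := congrArg a (Subsingleton.elim _ _)
  have hs (σ : Equiv.Perm (Fin q)) : ((Equiv.Perm.sign σ : ℤ) : ℝ) * b (v ∘ σ) = b v := by
    rw [show b (v ∘ σ) = Equiv.Perm.sign σ • b v from b.toAlternatingMap.map_perm v σ,
      Units.smul_def, zsmul_eq_mul, ← mul_assoc, ← Int.cast_mul,
      Int.units_coe_mul_self]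
    simp
  trans ∑ _σ : Equiv.Perm (Fin q), a 0 * b v
  · simp [Fintype.card_perm]
  · refine Finset.sum_congr rfl fun σ _ => ?_
    rw [ha ((v ∘ σ) ∘ leftIdx h), mul_left_comm, hs]

/-- This is what permits induction on the degree: an identity of forms follows from its contractions
with all vectors. -/
theorem ext_curryLeft {n : ℕ} {a b : E [⋀^Fin (n + 1)]→L[ℝ] ℝ}
    (h : ∀ x, a.curryLeft x = b.curryLeft x) : a = b := by
  ext v
  have := congrArg (fun f => f (Fin.tail v)) (h (v 0))
  simpa [ContinuousAlternatingMap.curryLeft_apply_apply, Matrix.vecCons] using this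

/-- Currying in the first argument, as a continuous linear map. -/
def curryLeftCLM (E : Type*) [NormedAddCommGroup E] [NormedSpace ℝ E] (n : ℕ) :
    (E [⋀^Fin (n + 1)]→L[ℝ] ℝ) →L[ℝ] E →L[ℝ] (E [⋀^Fin n]→L[ℝ] ℝ) :=
  ContinuousAlternatingMap.curryLeftLI.toContinuousLinearMap

@[simp]
theorem curryLeftCLM_apply {n : ℕ} (a : E [⋀^Fin (n + 1)]→L[ℝ] ℝ) :
    curryLeftCLM E n a = a.curryLeft := rfl

/-- Interior product with a fixed vector, as a continuous linear map. -/
def curryLeftAt (n : ℕ) (x : E) : (E [⋀^Fin (n + 1)]→L[ℝ] ℝ) →L[ℝ] (E [⋀^Fin n]→L[ℝ] ℝ) :=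
  (curryLeftCLM E n).flip x

@[simp]
theorem curryLeftAt_apply {n : ℕ} (x : E) (a : E [⋀^Fin (n + 1)]→L[ℝ] ℝ) :
    curryLeftAt n x a = a.curryLeft x := rfl

open ContinuousAlternatingMap in
theorem curryLeft_alternatizeUncurryFin_zero (G : E →L[ℝ] E [⋀^Fin 0]→L[ℝ] ℝ) (x : E) :
    (alternatizeUncurryFin G).curryLeft x = G x := by
  ext w
  simp [alternatizeUncurryFin_apply, curryLeft_apply_apply, Subsingleton.elim w 0]

-- An algebraic Cartan formula. The summand in which `x` is the direction of `G` gives `G x`; in the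
-- others `x` stays the first argument of the form, and the index shifts by one, whence the minus
-- sign.
open ContinuousAlternatingMap in
theorem curryLeft_alternatizeUncurryFin_succ {n : ℕ} (G : E →L[ℝ] E [⋀^Fin (n + 1)]→L[ℝ] ℝ)
    (x : E) :
    (alternatizeUncurryFin G).curryLeft x =
      G x - alternatizeUncurryFin ((curryLeftAt n x).comp G) := by
  ext w
  have hr (i : Fin (n + 1)) : Fin.removeNth i.succ (Matrix.vecCons x w) =
      Matrix.vecCons x (Fin.removeNth i w) := by
    ext k
    cases k using Fin.cases <;> simp [Fin.removeNth_apply]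
  simp only [alternatizeUncurryFin_apply, curryLeft_apply_apply,
    Fin.sum_univ_succ (n := n + 1), ContinuousAlternatingMap.sub_apply, hr]
  simp [sub_eq_add_neg, pow_succ, ← Finset.sum_neg_distrib, curryLeft_apply_apply]

end WedgeBilinear

/-! ### Leibniz rule and Cartan formula on a vector space -/

section FlatCalculus

variable {E : Type*} [NormedAddCommGroup E] [NormedSpace ℝ E]

open ContinuousAlternatingMap

theorem alternatizeUncurryFin_neg_pow_smul {n : ℕ} (p : ℕ) (G : E →L[ℝ] E [⋀^Fin n]→L[ℝ] ℝ) :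
    alternatizeUncurryFin ((-1 : ℝ) ^ p • G) = (-1 : ℝ) ^ p • alternatizeUncurryFin G :=
  map_smul (alternatizeUncurryFinCLM ℝ E ℝ) _ _

variable [FiniteDimensional ℝ E]

/-- Half of the Leibniz rule, as pure algebra: `A` plays the derivative of the left factor. Induct
on the total degree, contracting both sides with a vector; the cases record which factors have an
argument to contract. -/
theorem alternatizeUncurryFin_wedge_left {p q r : ℕ} (h : p + q = r)
    (A : E →L[ℝ] E [⋀^Fin p]→L[ℝ] ℝ) (b : E [⋀^Fin q]→L[ℝ] ℝ) :
    alternatizeUncurryFin (((wedgeCLM E h).flip b).comp A) =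
      wedgeAlt (show p + 1 + q = r + 1 by omega) (alternatizeUncurryFin A) b := by
  induction r generalizing p q with
  | zero =>
    obtain rfl : p = 0 := by omega
    obtain rfl : q = 0 := by omega
    refine ext_curryLeft fun x => ?_
    rw [curryLeft_alternatizeUncurryFin_zero, curryLeft_wedgeAlt]
    simp [curryWedgeLeft, curryWedgeRight, curryLeft_alternatizeUncurryFin_zero]
  | succ r ih =>
    refine ext_curryLeft fun x => ?_
    rw [curryLeft_alternatizeUncurryFin_succ, curryLeft_wedgeAlt]
    cases p with
    | zero =>
      cases q with
      | zero => omega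
      | succ q =>
        have h1 : (curryLeftAt r x).comp (((wedgeCLM E h).flip b).comp A) =
            ((wedgeCLM E (show 0 + q = r by omega)).flip (b.curryLeft x)).comp A := by
          ext1 v
          simp [curryLeft_wedgeAlt, curryWedgeLeft, curryWedgeRight]
        rw [h1, ih]
        simp [curryWedgeLeft, curryWedgeRight, curryLeft_alternatizeUncurryFin_zero]
        module
    | succ p =>
      cases q with
      | zero =>
        have h1 : (curryLeftAt r x).comp (((wedgeCLM E h).flip b).comp A) =
            ((wedgeCLM E (show p + 0 = r by omega)).flip b).comp ((curryLeftAt p x).comp A) := by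
          ext1 v
          simp [curryLeft_wedgeAlt, curryWedgeLeft, curryWedgeRight]
        rw [h1, ih]
        simp [curryWedgeLeft, curryWedgeRight, curryLeft_alternatizeUncurryFin_succ,
          wedgeAlt_sub_left]
      | succ q =>
        have h1 : (curryLeftAt r x).comp (((wedgeCLM E h).flip b).comp A) =
            ((wedgeCLM E (show p + (q + 1) = r by omega)).flip b).comp
              ((curryLeftAt p x).comp A) + (-1 : ℝ) ^ (p + 1) •
            ((wedgeCLM E (show p + 1 + q = r by omega)).flip (b.curryLeft x)).comp A := by
          ext1 v
          simp [curryLeft_wedgeAlt, curryWedgeLeft, curryWedgeRight]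
        rw [h1, alternatizeUncurryFin_add, alternatizeUncurryFin_neg_pow_smul, ih, ih]
        simp only [curryWedgeLeft, curryWedgeRight, curryLeft_alternatizeUncurryFin_succ,
          wedgeAlt_sub_left, ContinuousLinearMap.comp_apply, ContinuousLinearMap.flip_apply,
          wedgeCLM_apply, pow_succ]
        module

/-- The other half, by the same induction. The sign comes from moving the direction of
differentiation past the `p` arguments of `a`. -/
theorem alternatizeUncurryFin_wedge_right {p q r : ℕ} (h : p + q = r)
    (a : E [⋀^Fin p]→L[ℝ] ℝ) (B : E →L[ℝ] E [⋀^Fin q]→L[ℝ] ℝ) :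
    alternatizeUncurryFin ((wedgeCLM E h a).comp B) = (-1 : ℝ) ^ p •
      wedgeAlt (show p + (q + 1) = r + 1 by omega) a (alternatizeUncurryFin B) := by
  induction r generalizing p q with
  | zero =>
    obtain rfl : p = 0 := by omega
    obtain rfl : q = 0 := by omega
    refine ext_curryLeft fun x => ?_
    rw [curryLeft_alternatizeUncurryFin_zero]
    simp [curryLeft_wedgeAlt, curryWedgeLeft, curryWedgeRight,
      curryLeft_alternatizeUncurryFin_zero]
  | succ r ih =>
    refine ext_curryLeft fun x => ?_
    rw [curryLeft_alternatizeUncurryFin_succ, curryLeft_smul, _root_.smul_apply,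
      curryLeft_wedgeAlt]
    have hs : (-1 : ℝ) ^ p * (-1 : ℝ) ^ p = 1 := by rw [← mul_pow]; simp
    cases p with
    | zero =>
      cases q with
      | zero => omega
      | succ q =>
        have h1 : (curryLeftAt r x).comp ((wedgeCLM E h a).comp B) =
            (wedgeCLM E (show 0 + q = r by omega) a).comp ((curryLeftAt q x).comp B) := by
          ext1 v
          simp [curryLeft_wedgeAlt, curryWedgeLeft, curryWedgeRight]
        rw [h1, ih]
        simp [curryWedgeLeft, curryWedgeRight, curryLeft_alternatizeUncurryFin_succ,
          wedgeAlt_sub_right]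
    | succ p =>
      cases q with
      | zero =>
        have h1 : (curryLeftAt r x).comp ((wedgeCLM E h a).comp B) =
            (wedgeCLM E (show p + 0 = r by omega) (a.curryLeft x)).comp B := by
          ext1 v
          simp [curryLeft_wedgeAlt, curryWedgeLeft, curryWedgeRight]
        rw [h1, ih]
        simp only [curryWedgeLeft, curryWedgeRight, curryLeft_alternatizeUncurryFin_zero,
          ContinuousLinearMap.comp_apply, wedgeCLM_apply, smul_add, smul_smul, hs]
        simp only [pow_succ]
        module
      | succ q =>
        have h1 : (curryLeftAt r x).comp ((wedgeCLM E h a).comp B) =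
            (wedgeCLM E (show p + (q + 1) = r by omega) (a.curryLeft x)).comp B +
            (-1 : ℝ) ^ (p + 1) • (wedgeCLM E (show p + 1 + q = r by omega) a).comp
              ((curryLeftAt q x).comp B) := by
          ext1 v
          simp [curryLeft_wedgeAlt, curryWedgeLeft, curryWedgeRight]
        rw [h1, alternatizeUncurryFin_add, alternatizeUncurryFin_neg_pow_smul, ih, ih]
        simp only [curryWedgeLeft, curryWedgeRight, curryLeft_alternatizeUncurryFin_succ,
          ContinuousLinearMap.comp_apply, wedgeCLM_apply, smul_add, smul_smul, hs,
          wedgeAlt_sub_right]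
        simp only [pow_succ]
        module

/-- The Leibniz rule for the exterior derivative on a vector space. -/
theorem extDeriv_wedgeAlt {p q r : ℕ} (h : p + q = r) {α : E → E [⋀^Fin p]→L[ℝ] ℝ}
    {β : E → E [⋀^Fin q]→L[ℝ] ℝ} {x : E} (hα : DifferentiableAt ℝ α x)
    (hβ : DifferentiableAt ℝ β x) :
    extDeriv (fun y => wedgeAlt h (α y) (β y)) x =
      wedgeAlt (show p + 1 + q = r + 1 by omega) (extDeriv α x) (β x) + (-1 : ℝ) ^ p •
        wedgeAlt (show p + (q + 1) = r + 1 by omega) (α x) (extDeriv β x) := by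
  have hd : fderiv ℝ (fun y => wedgeAlt h (α y) (β y)) x =
      ((wedgeCLM E h).flip (β x)).comp (fderiv ℝ α x) +
        (wedgeCLM E h (α x)).comp (fderiv ℝ β x) := by
    have := ((wedgeCLM E h).hasFDerivAt_of_bilinear hα.hasFDerivAt hβ.hasFDerivAt).fderiv
    simp only [wedgeCLM_apply] at this
    rw [this, add_comm]
    rfl
  rw [extDeriv, hd, alternatizeUncurryFin_add, alternatizeUncurryFin_wedge_left,
    alternatizeUncurryFin_wedge_right]
  rfl

theorem contDiffAt_wedgeAlt {p q r : ℕ} (h : p + q = r) {n : WithTop ℕ∞} {G : Type*}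
    [NormedAddCommGroup G] [NormedSpace ℝ G] {α : G → E [⋀^Fin p]→L[ℝ] ℝ}
    {β : G → E [⋀^Fin q]→L[ℝ] ℝ} {x : G} (hα : ContDiffAt ℝ n α x)
    (hβ : ContDiffAt ℝ n β x) : ContDiffAt ℝ n (fun y => wedgeAlt h (α y) (β y)) x := by
  have h0 : ContDiff ℝ n (fun a => wedgeCLM E h a) := by fun_prop
  have h1 : ContDiffAt ℝ n (fun y => wedgeCLM E h (α y)) x := h0.contDiffAt.comp x hα
  exact h1.clm_apply hβ

omit [FiniteDimensional ℝ E] in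
theorem contDiffAt_curryLeft {p : ℕ} {n : WithTop ℕ∞} {α : E → E [⋀^Fin (p + 1)]→L[ℝ] ℝ}
    {V : E → E} {x : E} (hα : ContDiffAt ℝ n α x) (hV : ContDiffAt ℝ n V x) :
    ContDiffAt ℝ n (fun y => (α y).curryLeft (V y)) x := by
  have h0 : ContDiff ℝ n (fun a => curryLeftCLM E p a) := by fun_prop
  have h1 : ContDiffAt ℝ n (fun y => curryLeftCLM E p (α y)) x := h0.contDiffAt.comp x hα
  exact h1.clm_apply hV

omit [FiniteDimensional ℝ E] in
/-- Cartan's formula for functions on a vector space. -/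
theorem lieDerivFlat_zero (V : E → E) (α : E → E [⋀^Fin 0]→L[ℝ] ℝ) (y : E) :
    lieDerivFlat V α y = (extDeriv α y).curryLeft (V y) := by
  rw [extDeriv, curryLeft_alternatizeUncurryFin_zero, lieDerivFlat,
    fderivCompContinuousLinearMap_of_isEmpty]
  simp

omit [FiniteDimensional ℝ E] in
/-- Cartan's formula on a vector space. -/
theorem lieDerivFlat_succ {p : ℕ} {V : E → E} {α : E → E [⋀^Fin (p + 1)]→L[ℝ] ℝ} {y : E}
    (hα : DifferentiableAt ℝ α y) (hV : DifferentiableAt ℝ V y) :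
    lieDerivFlat V α y =
      (extDeriv α y).curryLeft (V y) + extDeriv (fun z => (α z).curryLeft (V z)) y := by
  have hd : fderiv ℝ (fun z => (α z).curryLeft (V z)) y =
      (curryLeftAt p (V y)).comp (fderiv ℝ α y) + (α y).curryLeft.comp (fderiv ℝ V y) := by
    have := ((curryLeftCLM E p).hasFDerivAt_of_bilinear hα.hasFDerivAt hV.hasFDerivAt).fderiv
    simp only [curryLeftCLM_apply] at this
    rw [this, add_comm]
    rfl
  -- The alternatisation of the contracted `fderiv ℝ α y` occurs with both signs and cancels. There
  -- remain the derivative of `α` along `V` and the alternatised term in the derivative of `V`.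
  rw [extDeriv, extDeriv, hd, alternatizeUncurryFin_add, curryLeft_alternatizeUncurryFin_succ,
    lieDerivFlat, fderivCompContinuousLinearMap_eq_alternatizeUncurryFin]
  have h2 : (((compContinuousLinearMapCLM (ContinuousLinearMap.id ℝ E)).comp
      (α y).curryLeft).postcomp E) (fderiv ℝ V y) = (α y).curryLeft.comp (fderiv ℝ V y) := by
    ext1 v
    exact ContinuousAlternatingMap.ext fun _ => rfl
  rw [ContinuousLinearMap.comp_apply, h2, alternatizeUncurryFinCLM_apply]
  abel

end FlatCalculus

/-! ### Smoothness of pulled-back forms on vector spaces -/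

section FlatPullback

variable {E : Type*} [NormedAddCommGroup E] [NormedSpace ℝ E]
  {E' : Type*} [NormedAddCommGroup E'] [NormedSpace ℝ E']
  {G : Type*} [NormedAddCommGroup G] [NormedSpace ℝ G]

open ContinuousAlternatingMap

theorem contDiffAt_of_forall_apply [FiniteDimensional ℝ E] {n : WithTop ℕ∞} {f : G → E →L[ℝ] E'}
    {x : G} (h : ∀ v, ContDiffAt ℝ n (fun z => f z v) x) : ContDiffAt ℝ n f x := by
  let d := Module.finrank ℝ E
  have hd : d = Module.finrank ℝ (Fin d → ℝ) := (Module.finrank_fin_fun ℝ).symm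
  let e₁ := ContinuousLinearEquiv.ofFinrankEq hd
  let e₂ := (e₁.arrowCongr (1 : E' ≃L[ℝ] E')).trans (ContinuousLinearEquiv.piRing (Fin d))
  rw [← id_comp f, ← e₂.symm_comp_self]
  exact e₂.symm.contDiff.contDiffAt.comp x (contDiffAt_pi.mpr fun i => h _)

/-- Alternatising the curried form returns `p + 1` times the form, so the form is a continuous
linear function of its contractions. -/
theorem contDiffAt_of_curryLeft [FiniteDimensional ℝ E] {p : ℕ} {n : WithTop ℕ∞}
    {α : G → E [⋀^Fin (p + 1)]→L[ℝ] ℝ} {x : G}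
    (h : ∀ v, ContDiffAt ℝ n (fun z => (α z).curryLeft v) x) : ContDiffAt ℝ n α x := by
  have h1 : ContDiffAt ℝ n (fun z => (α z).curryLeft) x := contDiffAt_of_forall_apply h
  have h2 : ContDiff ℝ n fun a => alternatizeUncurryFinCLM ℝ E ℝ (n := p) a := by fun_prop
  have h3 : ContDiffAt ℝ n
      (fun z => alternatizeUncurryFinCLM ℝ E ℝ (n := p) (α z).curryLeft) x :=
    h2.contDiffAt.comp x h1
  have h4 := h3.const_smul (((p : ℝ) + 1)⁻¹)
  refine h4.congr_of_eventuallyEq (Filter.Eventually.of_forall fun z => ?_)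
  have hp : (p : ℝ) + 1 ≠ 0 := by positivity
  change α z = ((p : ℝ) + 1)⁻¹ • alternatizeUncurryFin (α z).curryLeft
  rw [alternatizeUncurryFin_curryLeft, ← Nat.cast_smul_eq_nsmul ℝ, smul_smul]
  simp [hp]

theorem contDiffAt_curryLeft_apply {p : ℕ} {n : WithTop ℕ∞} {α : G → E [⋀^Fin (p + 1)]→L[ℝ] ℝ}
    {V : G → E} {x : G} (hα : ContDiffAt ℝ n α x) (hV : ContDiffAt ℝ n V x) :
    ContDiffAt ℝ n (fun y => (α y).curryLeft (V y)) x := by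
  have h0 : ContDiff ℝ n (fun a => curryLeftCLM E p a) := by fun_prop
  have h1 : ContDiffAt ℝ n (fun y => curryLeftCLM E p (α y)) x := h0.contDiffAt.comp x hα
  exact h1.clm_apply hV

/-- Contraction lowers the degree and commutes with composition up to applying `g` to the vector, so
smoothness follows by induction on `p`. -/
theorem contDiffAt_compContinuousLinearMap [FiniteDimensional ℝ E] {p : ℕ} {n : WithTop ℕ∞}
    {α : G → E' [⋀^Fin p]→L[ℝ] ℝ} {g : G → E →L[ℝ] E'} {x : G} (hα : ContDiffAt ℝ n α x)
    (hg : ContDiffAt ℝ n g x) :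
    ContDiffAt ℝ n (fun z => (α z).compContinuousLinearMap (g z)) x := by
  induction p with
  | zero =>
    have h0 : ContDiff ℝ n fun a : E' [⋀^Fin 0]→L[ℝ] ℝ =>
        compContinuousLinearMapCLM (0 : E →L[ℝ] E') a := by fun_prop
    refine (h0.contDiffAt.comp x hα).congr_of_eventuallyEq (Filter.Eventually.of_forall fun z => ?_)
    ext v
    exact congrArg (α z) (Subsingleton.elim _ _)
  | succ p ih =>
    refine contDiffAt_of_curryLeft fun v => ?_
    simp only [curryLeft_compContinuousLinearMap]
    exact ih (contDiffAt_curryLeft_apply hα (hg.clm_apply contDiffAt_const))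

end FlatPullback

theorem two_le_infty : (2 : WithTop ℕ∞) ≤ ∞ :=
  WithTop.coe_le_coe.2 (le_top : (2 : ℕ∞) ≤ ⊤)

/-! ### Pull-backs on manifolds and naturality of the exterior derivative -/

section Naturality

variable {E : Type*} [NormedAddCommGroup E] [NormedSpace ℝ E]
  {M : Type*} [TopologicalSpace M] [ChartedSpace E M]
  {E' : Type*} [NormedAddCommGroup E'] [NormedSpace ℝ E']
  {N : Type*} [TopologicalSpace N] [ChartedSpace E' N]
  {E'' : Type*} [NormedAddCommGroup E''] [NormedSpace ℝ E'']
  {N' : Type*} [TopologicalSpace N'] [ChartedSpace E'' N']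

theorem pullback_comp {p : ℕ} {g : N → N'} {f : M → N} (α : DForm E'' N' p) {x : M}
    (hg : MDifferentiableAt 𝓘(ℝ, E') 𝓘(ℝ, E'') g (f x))
    (hf : MDifferentiableAt 𝓘(ℝ, E) 𝓘(ℝ, E') f x) :
    pullback (g ∘ f) α x = pullback (E := E) f (pullback (E := E') g α) x := by
  unfold pullback
  rw [mfderiv_comp x hg hf]
  rfl

theorem pullback_congr {p : ℕ} {f g : M → N} (α : DForm E' N p) {x : M} (h : f =ᶠ[𝓝 x] g) :
    pullback (E := E) f α x = pullback g α x := by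
  unfold pullback
  rw [h.mfderiv_eq, h.eq_of_nhds]

theorem pullback_of_eventuallyEq_id {p : ℕ} {f : M → M} (α : DForm E M p) {x : M}
    (h : f =ᶠ[𝓝 x] id) : pullback f α x = α x := by
  rw [pullback_congr α h]
  unfold pullback
  rw [mfderiv_id]
  rfl

theorem pullback_apply_of_eq {p : ℕ} (f : M → N) {α β : DForm E' N p} {x : M}
    (h : α (f x) = β (f x)) : pullback (E := E) f α x = pullback f β x := by
  unfold pullback
  rw [h]

theorem pullback_flat {p : ℕ} (f : E → E') (α : DForm E' E' p) (x : E) :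
    pullback f α x = (α (f x)).compContinuousLinearMap (fderiv ℝ f x) := by
  unfold pullback
  rw [mfderiv_eq_fderiv]

theorem chartForm_self {p : ℕ} (α : DForm E E p) (x₀ : E) : chartForm α x₀ = α := by
  ext1 x
  exact pullback_of_eventuallyEq_id α (Filter.Eventually.of_forall fun y => by
    rw [extChartAt_model_space_eq_id]
    rfl)

/-- The form `α` is smooth at the point `x`. -/
def SmoothFormAt {p : ℕ} (α : DForm E M p) (x : M) : Prop :=
  ContDiffAt ℝ ∞ (chartForm α x) (extChartAt 𝓘(ℝ, E) x x)

theorem smoothFormAt_self_iff {p : ℕ} {α : DForm E E p} {x : E} :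
    SmoothFormAt α x ↔ ContDiffAt ℝ ∞ α x := by
  rw [SmoothFormAt, chartForm_self, extChartAt_model_space_eq_id]
  rfl

theorem SmoothForm.smoothFormAt {p : ℕ} {α : DForm E M p} (h : SmoothForm α) (x : M) :
    SmoothFormAt α x :=
  (h x).contDiffAt (extChartAt_target_mem_nhds x)

theorem SmoothForm.contDiffAt_chartForm {p : ℕ} {α : DForm E M p} (h : SmoothForm α) (x : M)
    {z : E} (hz : z ∈ (extChartAt 𝓘(ℝ, E) x).target) : ContDiffAt ℝ ∞ (chartForm α x) z :=
  (h x).contDiffAt ((isOpen_extChartAt_target x).mem_nhds hz)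

variable [IsManifold 𝓘(ℝ, E) ∞ M] [IsManifold 𝓘(ℝ, E') ∞ N]

theorem contMDiffAt_extChartAt_symm (x : M) {z : E} (hz : z ∈ (extChartAt 𝓘(ℝ, E) x).target) :
    ContMDiffAt 𝓘(ℝ, E) 𝓘(ℝ, E) ∞ (extChartAt 𝓘(ℝ, E) x).symm z :=
  (contMDiffOn_extChartAt_symm x).contMDiffAt ((isOpen_extChartAt_target x).mem_nhds hz)

theorem contMDiffAt_extChartAt_of_mem (x : M) {y : M} (hy : y ∈ (extChartAt 𝓘(ℝ, E) x).source) :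
    ContMDiffAt 𝓘(ℝ, E) 𝓘(ℝ, E) ∞ (extChartAt 𝓘(ℝ, E) x) y :=
  contMDiffAt_extChartAt' (by simpa using hy)

theorem pullback_chartForm {p : ℕ} (α : DForm E M p) (x : M) {y : M}
    (hy : y ∈ (extChartAt 𝓘(ℝ, E) x).source) :
    pullback (extChartAt 𝓘(ℝ, E) x) (chartForm α x) y = α y := by
  have hz := (extChartAt 𝓘(ℝ, E) x).map_source hy
  rw [chartForm, ← pullback_comp α
    ((contMDiffAt_extChartAt_symm x hz).mdifferentiableAt (by simp))
    ((contMDiffAt_extChartAt_of_mem x hy).mdifferentiableAt (by simp))]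
  refine pullback_of_eventuallyEq_id α ?_
  filter_upwards [(isOpen_extChartAt_source x).mem_nhds hy] with w hw
  exact (extChartAt 𝓘(ℝ, E) x).left_inv hw

/-- The expression of a map in the preferred charts. -/
def inCharts (f : M → N) (x : M) : E → E' :=
  extChartAt 𝓘(ℝ, E') (f x) ∘ f ∘ (extChartAt 𝓘(ℝ, E) x).symm

omit [IsManifold 𝓘(ℝ, E) ∞ M] [IsManifold 𝓘(ℝ, E') ∞ N] in
theorem contDiffAt_inCharts {f : M → N} {x : M} (hf : ContMDiffAt 𝓘(ℝ, E) 𝓘(ℝ, E') ∞ f x) :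
    ContDiffAt ℝ ∞ (inCharts (E := E) (E' := E') f x) (extChartAt 𝓘(ℝ, E) x x) := by
  have := (contMDiffAt_iff.1 hf).2
  simpa [inCharts, contDiffWithinAt_univ] using this

omit [IsManifold 𝓘(ℝ, E) ∞ M] [IsManifold 𝓘(ℝ, E') ∞ N] in
theorem inCharts_apply_extChartAt (f : M → N) (x : M) :
    inCharts (E := E) (E' := E') f x (extChartAt 𝓘(ℝ, E) x x) =
      extChartAt 𝓘(ℝ, E') (f x) (f x) := by
  simp [inCharts]

/-- Reduces pull-backs between manifolds to pull-backs between vector spaces. It holds only near the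
centre, because `f` has to stay in the chart around `f x`. -/
theorem chartForm_pullback_eventuallyEq {p : ℕ} {f : M → N} (α : DForm E' N p) {x : M}
    (hf : ContMDiffAt 𝓘(ℝ, E) 𝓘(ℝ, E') ∞ f x) :
    chartForm (pullback (E := E) f α) x =ᶠ[𝓝 (extChartAt 𝓘(ℝ, E) x x)] fun z =>
      (chartForm α (f x) (inCharts (E := E) f x z)).compContinuousLinearMap
        (fderiv ℝ (inCharts (E := E) (E' := E') f x) z) := by
  have hcont : Filter.Tendsto (extChartAt 𝓘(ℝ, E) x).symm (𝓝 (extChartAt 𝓘(ℝ, E) x x)) (𝓝 x) := by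
    simpa using (continuousAt_extChartAt_symm (I := 𝓘(ℝ, E)) x).tendsto
  have h1 : ∀ᶠ y in 𝓝 x, ContMDiffAt 𝓘(ℝ, E) 𝓘(ℝ, E') 1 f y :=
    (contMDiffAt_iff_contMDiffAt_nhds (by simp)).1 (hf.of_le (by norm_num))
  have h2 : ∀ᶠ y in 𝓝 x, f y ∈ (extChartAt 𝓘(ℝ, E') (f x)).source :=
    hf.continuousAt.preimage_mem_nhds (extChartAt_source_mem_nhds (f x))
  filter_upwards [extChartAt_target_mem_nhds x, hcont.eventually h1, hcont.eventually h2]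
    with z hz hz1 hz2
  have hs := (contMDiffAt_extChartAt_symm x hz).mdifferentiableAt (by simp)
  have hfd := hz1.mdifferentiableAt (by simp)
  have hc := (contMDiffAt_extChartAt_of_mem (f x) hz2).mdifferentiableAt (by simp)
  rw [← pullback_flat (inCharts f x) (chartForm α (f x)) z, inCharts,
    ← comp_assoc, pullback_comp _ (hc.comp _ hfd) hs]
  refine pullback_apply_of_eq _ ?_
  rw [pullback_comp _ hc hfd]
  exact pullback_apply_of_eq _ (pullback_chartForm α (f x) hz2).symm

theorem SmoothFormAt.pullback [FiniteDimensional ℝ E] {p : ℕ} {f : M → N} {α : DForm E' N p}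
    {x : M} (hα : SmoothFormAt α (f x)) (hf : ContMDiffAt 𝓘(ℝ, E) 𝓘(ℝ, E') ∞ f x) :
    SmoothFormAt (pullback (E := E) f α) x := by
  refine ContDiffAt.congr_of_eventuallyEq ?_ (chartForm_pullback_eventuallyEq α hf)
  have hF := contDiffAt_inCharts hf
  refine contDiffAt_compContinuousLinearMap (ContDiffAt.comp _ ?_ hF)
    (hF.fderiv_right (m := ∞) (by simp))
  rw [inCharts_apply_extChartAt]
  exact hα

/-- The hypothesis tests each point in its own chart, the conclusion a fixed chart on its whole
target; pulling back along the inverse of the fixed chart passes from one to the other. -/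
theorem SmoothForm.of_smoothFormAt [FiniteDimensional ℝ E] {p : ℕ}
    {α : DForm E M p} (h : ∀ x, SmoothFormAt α x) : SmoothForm α := fun x₀ _ hz =>
  (smoothFormAt_self_iff.1 ((h _).pullback (contMDiffAt_extChartAt_symm x₀ hz))).contDiffWithinAt

/-- Read in charts, this is naturality on vector spaces. Taking `f` to be an inverse chart also
shows that `extD` does not depend on the chart chosen at each point. -/
theorem extD_pullback [FiniteDimensional ℝ E] {p : ℕ} {f : M → N} {α : DForm E' N p}
    {x : M} (hα : SmoothFormAt α (f x)) (hf : ContMDiffAt 𝓘(ℝ, E) 𝓘(ℝ, E') ∞ f x) :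
    extD (pullback (E := E) f α) x = pullback f (extD α) x := by
  have hF := contDiffAt_inCharts hf
  have hα' : DifferentiableAt ℝ (chartForm α (f x))
      (inCharts (E := E) f x (extChartAt 𝓘(ℝ, E) x x)) := by
    rw [inCharts_apply_extChartAt]
    exact hα.differentiableAt (by simp)
  have hx := mem_extChartAt_source (I := 𝓘(ℝ, E)) x
  have hz := mem_extChartAt_target (I := 𝓘(ℝ, E)) x
  have hfx := mem_extChartAt_source (I := 𝓘(ℝ, E')) (f x)
  have hfd := hf.mdifferentiableAt (by simp)
  have hc := (contMDiffAt_extChartAt_of_mem (f x) hfx).mdifferentiableAt (by simp)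
  have hd := (contMDiffAt_extChartAt_of_mem x hx).mdifferentiableAt (by simp)
  trans ShearConstruction.pullback (E := E) (E' := E) (extChartAt 𝓘(ℝ, E) x)
    (ShearConstruction.pullback (E := E) (E' := E') (inCharts (E := E) f x) (extDeriv (chartForm α (f x)))) x
  · refine pullback_apply_of_eq _ ?_
    rw [(chartForm_pullback_eventuallyEq α hf).extDeriv_eq, pullback_flat]
    exact extDeriv_pullback hα' hF
      (by rw [minSmoothness_of_isRCLikeNormedField]; exact two_le_infty)
  · rw [← pullback_comp _ (hF.differentiableAt (by simp)).mdifferentiableAt hd]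
    trans ShearConstruction.pullback (E := E) (E' := E') (extChartAt 𝓘(ℝ, E') (f x) ∘ f)
      (extDeriv (chartForm α (f x))) x
    · refine pullback_congr _ ?_
      filter_upwards [(isOpen_extChartAt_source x).mem_nhds hx] with w hw
      simp only [inCharts, comp_apply, (extChartAt 𝓘(ℝ, E) x).left_inv hw]
    · rw [pullback_comp _ hc hfd]
      rfl

end Naturality

/-! ### Exterior derivative, interior product and Lie derivative on manifolds -/

section Calculus

variable {E : Type*} [NormedAddCommGroup E] [NormedSpace ℝ E]
  {M : Type*} [TopologicalSpace M] [ChartedSpace E M]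
  {E' : Type*} [NormedAddCommGroup E'] [NormedSpace ℝ E']
  {N : Type*} [TopologicalSpace N] [ChartedSpace E' N]

/-- The differential of a map, as a linear map between the model spaces. -/
def tmap (E E' : Type*) [NormedAddCommGroup E] [NormedSpace ℝ E] [NormedAddCommGroup E']
    [NormedSpace ℝ E'] {M N : Type*} [TopologicalSpace M] [ChartedSpace E M] [TopologicalSpace N]
    [ChartedSpace E' N] (f : M → N) (x : M) : E →L[ℝ] E' :=
  mfderiv 𝓘(ℝ, E) 𝓘(ℝ, E') f x

theorem pullback_apply {p : ℕ} (f : M → N) (α : DForm E' N p) (x : M) :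
    pullback (E := E) f α x = (α (f x)).compContinuousLinearMap (tmap E E' f x) := rfl

theorem curryLeft_pullback {p : ℕ} (f : M → N) (α : DForm E' N (p + 1)) (x : M) (v : E) :
    (pullback (E := E) f α x).curryLeft v =
      ((α (f x)).curryLeft (tmap E E' f x v)).compContinuousLinearMap (tmap E E' f x) :=
  ContinuousAlternatingMap.curryLeft_compContinuousLinearMap _ _ _

theorem tmap_comp_apply {E'' : Type*} [NormedAddCommGroup E''] [NormedSpace ℝ E'']
    {N' : Type*} [TopologicalSpace N'] [ChartedSpace E'' N'] {g : N → N'} {f : M → N} {x : M}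
    (hg : MDifferentiableAt 𝓘(ℝ, E') 𝓘(ℝ, E'') g (f x))
    (hf : MDifferentiableAt 𝓘(ℝ, E) 𝓘(ℝ, E') f x) (v : E) :
    tmap E E'' (g ∘ f) x v = tmap E' E'' g (f x) (tmap E E' f x v) := by
  unfold tmap
  rw [mfderiv_comp x hg hf]
  rfl

theorem tmap_congr {f g : M → N} {x : M} (h : f =ᶠ[𝓝 x] g) : tmap E E' f x = tmap E E' g x :=
  h.mfderiv_eq

theorem tmap_of_eventuallyEq_id {f : M → M} {x : M} (h : f =ᶠ[𝓝 x] id) (v : E) :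
    tmap E E f x v = v := by
  rw [tmap_congr h]
  unfold tmap
  rw [mfderiv_id]
  rfl

/-! ### Algebraic operations and pull-backs -/

theorem pullback_add {p : ℕ} (f : M → N) (α β : DForm E' N p) :
    pullback (E := E) f (α + β) = pullback f α + pullback f β := rfl

theorem pullback_smul {p : ℕ} (f : M → N) (c : ℝ) (α : DForm E' N p) :
    pullback (E := E) f (c • α) = c • pullback f α := rfl

theorem pullback_wedge {p q r : ℕ} (h : p + q = r) (f : M → N) (α : DForm E' N p)
    (β : DForm E' N q) :
    pullback (E := E) f (wedge h α β) = wedge h (pullback f α) (pullback f β) := by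
  ext1 x
  exact wedgeAlt_compContinuousLinearMap h _ _ _

theorem chartForm_add {p : ℕ} (α β : DForm E M p) (x : M) :
    chartForm (α + β) x = chartForm α x + chartForm β x := rfl

theorem chartForm_smul {p : ℕ} (c : ℝ) (α : DForm E M p) (x : M) :
    chartForm (c • α) x = c • chartForm α x := rfl

theorem chartForm_wedge {p q r : ℕ} (h : p + q = r) (α : DForm E M p) (β : DForm E M q) (x : M) :
    chartForm (wedge h α β) x = fun z => wedgeAlt h (chartForm α x z) (chartForm β x z) :=
  pullback_wedge h _ α β

theorem SmoothForm.add {p : ℕ} {α β : DForm E M p} (hα : SmoothForm α) (hβ : SmoothForm β) :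
    SmoothForm (α + β) := fun x => (hα x).add (hβ x)

theorem SmoothForm.sub {p : ℕ} {α β : DForm E M p} (hα : SmoothForm α) (hβ : SmoothForm β) :
    SmoothForm (α - β) := fun x => (hα x).sub (hβ x)

theorem SmoothForm.const_smul {p : ℕ} (c : ℝ) {α : DForm E M p} (hα : SmoothForm α) :
    SmoothForm (c • α) := fun x => (hα x).const_smul c

theorem SmoothForm.zero {p : ℕ} : SmoothForm (0 : DForm E M p) := fun _ =>
  contDiffOn_const (c := (0 : E [⋀^Fin p]→L[ℝ] ℝ))

theorem SmoothForm.wedge [FiniteDimensional ℝ E] {p q r : ℕ} (h : p + q = r) {α : DForm E M p}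
    {β : DForm E M q} (hα : SmoothForm α) (hβ : SmoothForm β) : SmoothForm (wedge h α β) :=
  fun x z hz => by
    rw [chartForm_wedge]
    exact (contDiffAt_wedgeAlt h (hα.contDiffAt_chartForm x hz)
      (hβ.contDiffAt_chartForm x hz)).contDiffWithinAt

omit [TopologicalSpace M] [ChartedSpace E M] in
theorem wedge_ofFun_left {q : ℕ} (h : 0 + q = q) (f : M → ℝ) (β : DForm E M q) :
    wedge h (ofFun E f) β = fmul f β := by
  ext1 x
  exact wedgeAlt_degree_zero_left h _ _

theorem SmoothForm.ofFun [IsManifold 𝓘(ℝ, E) ∞ M] {f : M → ℝ}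
    (hf : ContMDiff 𝓘(ℝ, E) 𝓘(ℝ, ℝ) ∞ f) : SmoothForm (ofFun E f) := fun x z hz => by
  have h1 : ContDiffAt ℝ ∞ (f ∘ (extChartAt 𝓘(ℝ, E) x).symm) z :=
    (hf.contMDiffAt.comp z (contMDiffAt_extChartAt_symm x hz)).contDiffAt
  have h2 : ContDiff ℝ ∞ fun c : ℝ =>
      ContinuousAlternatingMap.constOfIsEmptyLIE ℝ E ℝ (Fin 0) c :=
    (ContinuousAlternatingMap.constOfIsEmptyLIE ℝ E ℝ (Fin 0)).contDiff
  exact (h2.contDiffAt.comp z h1).contDiffWithinAt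

theorem SmoothForm.fmul [FiniteDimensional ℝ E] [IsManifold 𝓘(ℝ, E) ∞ M] {p : ℕ} {f : M → ℝ}
    {α : DForm E M p} (hf : ContMDiff 𝓘(ℝ, E) 𝓘(ℝ, ℝ) ∞ f) (hα : SmoothForm α) :
    SmoothForm (fmul f α) := by
  rw [← wedge_ofFun_left (Nat.zero_add p)]
  exact (SmoothForm.ofFun hf).wedge _ hα

/-! ### The exterior derivative -/

theorem extD_add {p : ℕ} {α β : DForm E M p} (hα : SmoothForm α) (hβ : SmoothForm β) :
    extD (α + β) = extD α + extD β := by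
  ext1 x
  trans pullback (extChartAt 𝓘(ℝ, E) x) (extDeriv (chartForm α x) + extDeriv (chartForm β x)) x
  · refine pullback_apply_of_eq _ ?_
    rw [chartForm_add]
    exact extDeriv_add ((hα.smoothFormAt x).differentiableAt (by simp))
      ((hβ.smoothFormAt x).differentiableAt (by simp))
  · rfl

theorem extD_smul {p : ℕ} (c : ℝ) (α : DForm E M p) : extD (c • α) = c • extD α := by
  ext1 x
  trans pullback (extChartAt 𝓘(ℝ, E) x) (c • extDeriv (chartForm α x)) x
  · refine pullback_apply_of_eq _ ?_
    rw [chartForm_smul]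
    exact extDeriv_smul _ _
  · rfl

theorem extD_sub {p : ℕ} {α β : DForm E M p} (hα : SmoothForm α) (hβ : SmoothForm β) :
    extD (α - β) = extD α - extD β := by
  have h := extD_add hα (hβ.const_smul (-1))
  rw [extD_smul] at h
  rwa [show α - β = α + (-1 : ℝ) • β by module, show extD α - extD β = extD α + (-1 : ℝ) • extD β
    by module]

variable [IsManifold 𝓘(ℝ, E) ∞ M]

/-- The Leibniz rule. -/
theorem extD_wedge [FiniteDimensional ℝ E] {p q r : ℕ} (h : p + q = r) {α : DForm E M p}
    {β : DForm E M q} (hα : SmoothForm α) (hβ : SmoothForm β) :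
    extD (wedge h α β) = wedge (show p + 1 + q = r + 1 by omega) (extD α) β +
      (-1 : ℝ) ^ p • wedge (show p + (q + 1) = r + 1 by omega) α (extD β) := by
  ext1 x
  trans pullback (E := E) (E' := E) (extChartAt 𝓘(ℝ, E) x)
    (wedge (show p + 1 + q = r + 1 by omega) (extDeriv (chartForm α x)) (chartForm β x) +
      (-1 : ℝ) ^ p • wedge (show p + (q + 1) = r + 1 by omega) (chartForm α x)
        (extDeriv (chartForm β x))) x
  · refine pullback_apply_of_eq _ ?_
    rw [chartForm_wedge]
    exact extDeriv_wedgeAlt h ((hα.smoothFormAt x).differentiableAt (by simp))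
      ((hβ.smoothFormAt x).differentiableAt (by simp))
  · have hx := mem_extChartAt_source (I := 𝓘(ℝ, E)) x
    rw [pullback_add, pullback_smul, pullback_wedge, pullback_wedge]
    simp only [Pi.add_apply, Pi.smul_apply, wedge, pullback_chartForm _ _ hx]
    rfl

theorem extD_eq_extDeriv [FiniteDimensional ℝ E] {p : ℕ} (α : DForm E E p) :
    extD α = extDeriv α := by
  ext1 x
  unfold extD
  rw [chartForm_self, extChartAt_model_space_eq_id]
  exact pullback_of_eventuallyEq_id _ (Filter.Eventually.of_forall fun _ => rfl)

/-- One chart computes `extD` on its whole target, although the definition changes chart from point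
to point. Smoothness of `extD α` and `d² = 0` thereby become statements on a vector space. -/
theorem chartForm_extD [FiniteDimensional ℝ E] {p : ℕ} {α : DForm E M p} (hα : SmoothForm α)
    (x : M) {z : E} (hz : z ∈ (extChartAt 𝓘(ℝ, E) x).target) :
    chartForm (extD α) x z = extDeriv (chartForm α x) z := by
  rw [← extD_eq_extDeriv, chartForm, chartForm]
  exact (extD_pullback (hα.smoothFormAt _) (contMDiffAt_extChartAt_symm x hz)).symm

theorem contDiffAt_extDeriv {p : ℕ} {α : DForm E E p} {z : E} (h : ContDiffAt ℝ ∞ α z) :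
    ContDiffAt ℝ ∞ (extDeriv α) z := by
  have h1 : ContDiffAt ℝ ∞ (fderiv ℝ α) z := h.fderiv_right (by simp)
  have h2 : ContDiff ℝ ∞ fun A : E →L[ℝ] E [⋀^Fin p]→L[ℝ] ℝ =>
    ContinuousAlternatingMap.alternatizeUncurryFinCLM ℝ E ℝ A := by fun_prop
  exact h2.contDiffAt.comp z h1

theorem SmoothForm.extD [FiniteDimensional ℝ E] {p : ℕ} {α : DForm E M p} (hα : SmoothForm α) :
    SmoothForm (extD α) := fun x =>
  ContDiffOn.congr (fun _ hz => (contDiffAt_extDeriv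
    (hα.contDiffAt_chartForm x hz)).contDiffWithinAt) fun _ hz => chartForm_extD hα x hz

theorem extD_extD [FiniteDimensional ℝ E] {p : ℕ} {α : DForm E M p} (hα : SmoothForm α) :
    extD (extD α) = 0 := by
  ext1 x
  trans pullback (E' := E) (extChartAt 𝓘(ℝ, E) x) (0 : DForm E E (p + 1 + 1)) x
  · refine pullback_apply_of_eq _ ?_
    have h : chartForm (ShearConstruction.extD α) x =ᶠ[𝓝 (extChartAt 𝓘(ℝ, E) x x)]
        extDeriv (chartForm α x) := by
      filter_upwards [extChartAt_target_mem_nhds x] with z hz using chartForm_extD hα x hz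
    rw [h.extDeriv_eq]
    exact extDeriv_extDeriv_apply (hα.smoothFormAt x)
      (by rw [minSmoothness_of_isRCLikeNormedField]; exact two_le_infty)
  · rfl

/-! ### Interior product and Lie derivative -/

theorem mfderiv_extChartAt_symm_isInvertible (x : M) {z : E}
    (hz : z ∈ (extChartAt 𝓘(ℝ, E) x).target) :
    (mfderiv 𝓘(ℝ, E) 𝓘(ℝ, E) (extChartAt 𝓘(ℝ, E) x).symm z).IsInvertible := by
  have := isInvertible_mfderivWithin_extChartAt_symm (I := 𝓘(ℝ, E)) hz
  simpa [mfderivWithin_univ] using this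

theorem tmap_symm_chartField (X : VField E M) (x : M) {z : E}
    (hz : z ∈ (extChartAt 𝓘(ℝ, E) x).target) :
    tmap E E (extChartAt 𝓘(ℝ, E) x).symm z (chartField X x z) =
      X ((extChartAt 𝓘(ℝ, E) x).symm z) :=
  (mfderiv_extChartAt_symm_isInvertible x hz).self_apply_inverse _

theorem chartForm_interior {p : ℕ} (X : VField E M) (α : DForm E M (p + 1)) (x : M) {z : E}
    (hz : z ∈ (extChartAt 𝓘(ℝ, E) x).target) :
    chartForm (interior X α) x z = (chartForm α x z).curryLeft (chartField X x z) := by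
  rw [chartForm, chartForm, curryLeft_pullback, tmap_symm_chartField X x hz]
  rfl

theorem contDiffAt_chartField [FiniteDimensional ℝ E] {X : VField E M}
    (hX : SmoothFieldOn X univ) (x : M) {z : E} (hz : z ∈ (extChartAt 𝓘(ℝ, E) x).target) :
    ContDiffAt ℝ ∞ (chartField X x) z := by
  have := FiniteDimensional.complete ℝ E
  exact contMDiffAt_vectorSpace_iff_contDiffAt.1 (ContMDiffAt.mpullback_vectorField_preimage
    ((contMDiffOn_univ.1 hX).contMDiffAt) (contMDiffAt_extChartAt_symm x hz)
    (mfderiv_extChartAt_symm_isInvertible x hz) (by simp))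

theorem SmoothForm.interior [FiniteDimensional ℝ E] {X : VField E M} (hX : SmoothFieldOn X univ)
    {p : ℕ} {α : DForm E M (p + 1)} (hα : SmoothForm α) : SmoothForm (interior X α) := fun x =>
  ContDiffOn.congr (fun _ hz => (contDiffAt_curryLeft (hα.contDiffAt_chartForm x hz)
    (contDiffAt_chartField hX x hz)).contDiffWithinAt) fun _ hz => chartForm_interior X α x hz

/-- The chart field corresponds to `X` under the differential of the chart, so contraction commutes
with this pull-back. This carries Cartan's formula from the model space to `M`. -/
theorem pullback_extChartAt_curryLeft {p : ℕ} (X : VField E M) (x : M)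
    (a : DForm E E (p + 1)) :
    pullback (E := E) (extChartAt 𝓘(ℝ, E) x)
        (fun z => (a z).curryLeft (chartField X x z)) x =
      (pullback (E := E) (extChartAt 𝓘(ℝ, E) x) a x).curryLeft (X x) := by
  have hx := mem_extChartAt_source (I := 𝓘(ℝ, E)) x
  have hz := mem_extChartAt_target (I := 𝓘(ℝ, E)) x
  have h : chartField X x (extChartAt 𝓘(ℝ, E) x x) =
      tmap E E (extChartAt 𝓘(ℝ, E) x) x (X x) := by
    refine ((mfderiv_extChartAt_symm_isInvertible x hz).inverse_apply_eq).2 ?_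
    have h1 : (X ((extChartAt 𝓘(ℝ, E) x).symm (extChartAt 𝓘(ℝ, E) x x)) : E) = X x :=
      congrArg (fun y => (X y : E)) ((extChartAt 𝓘(ℝ, E) x).left_inv hx)
    refine h1.trans ?_
    have h2 := tmap_comp_apply
      ((contMDiffAt_extChartAt_symm x hz).mdifferentiableAt (by simp))
      ((contMDiffAt_extChartAt_of_mem x hx).mdifferentiableAt (by simp)) (X x)
    refine (tmap_of_eventuallyEq_id (E := E) ?_ (X x)).symm.trans h2
    filter_upwards [(isOpen_extChartAt_source x).mem_nhds hx] with w hw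
    exact (extChartAt 𝓘(ℝ, E) x).left_inv hw
  refine Eq.trans ?_ (curryLeft_pullback (E := E) (E' := E) _ a x (X x)).symm
  exact congrArg (fun w : E => ((a (extChartAt 𝓘(ℝ, E) x x)).curryLeft w).compContinuousLinearMap
    (tmap E E (extChartAt 𝓘(ℝ, E) x) x)) h

/-- Cartan's formula for functions. -/
theorem lieD_zero (X : VField E M) (α : DForm E M 0) : lieD X α = interior X (extD α) := by
  ext1 x
  refine Eq.trans ?_ (pullback_extChartAt_curryLeft X x (extDeriv (chartForm α x)))
  exact pullback_apply_of_eq _ (lieDerivFlat_zero _ _ _)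

/-- Cartan's formula. -/
theorem lieD_succ [FiniteDimensional ℝ E] {X : VField E M} (hX : SmoothFieldOn X univ) {p : ℕ}
    {α : DForm E M (p + 1)} (hα : SmoothForm α) :
    lieD X α = interior X (extD α) + extD (interior X α) := by
  ext1 x
  have hz := mem_extChartAt_target (I := 𝓘(ℝ, E)) x
  trans pullback (E := E) (E' := E) (extChartAt 𝓘(ℝ, E) x) ((fun z =>
    (extDeriv (chartForm α x) z).curryLeft (chartField X x z)) +
      extDeriv (chartForm (interior X α) x)) x
  · refine pullback_apply_of_eq _ ?_
    rw [lieDerivFlat_succ ((hα.smoothFormAt x).differentiableAt (by simp))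
      ((contDiffAt_chartField hX x hz).differentiableAt (by simp)), Pi.add_apply]
    congr 1
    refine Filter.EventuallyEq.extDeriv_eq ?_
    filter_upwards [extChartAt_target_mem_nhds x] with z hz
    exact (chartForm_interior X α x hz).symm
  · exact congrArg (· + extD (interior X α) x)
      (pullback_extChartAt_curryLeft X x (extDeriv (chartForm α x)))

end Calculus

/-! ### Forms annihilated by the kernel of a linear map -/

section Basic

variable {E : Type*} [NormedAddCommGroup E] [NormedSpace ℝ E]
  {E' : Type*} [NormedAddCommGroup E'] [NormedSpace ℝ E']

/-- The alternating form `a` vanishes as soon as one of its arguments is in the kernel of `l`. -/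
def VanishesOnKer {k : ℕ} (l : E →L[ℝ] E') (a : E [⋀^Fin k]→L[ℝ] ℝ) : Prop :=
  ∀ (w : Fin k → E) (i : Fin k), l (w i) = 0 → a w = 0

theorem VanishesOnKer.apply_eq {k : ℕ} {l : E →L[ℝ] E'} {a : E [⋀^Fin k]→L[ℝ] ℝ}
    (ha : VanishesOnKer l a) {w w' : Fin k → E} (h : ∀ i, l (w i) = l (w' i)) : a w = a w' := by
  classical
  -- Exchange the arguments one at a time; each exchange changes the value by a term with an
  -- argument `w i - w' i` in the kernel.
  have key (s : Finset (Fin k)) : a (s.piecewise w w') = a w' := by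
    induction s using Finset.induction_on with
    | empty => simp
    | insert i s hi ih =>
      rw [Finset.piecewise_insert, ← ih, ← sub_eq_zero]
      have h1 := a.toAlternatingMap.map_update_sub (s.piecewise w w') i (w i) (w' i)
      have h2 : update (s.piecewise w w') i (w' i) = s.piecewise w w' := by
        rw [update_eq_self_iff, Finset.piecewise_eq_of_notMem _ _ _ hi]
      rw [h2] at h1
      refine h1.symm.trans (ha _ i ?_)
      simp [h i]
  simpa using key Finset.univ

theorem vanishesOnKer_compContinuousLinearMap {k : ℕ} (l : E →L[ℝ] E')
    (a : E' [⋀^Fin k]→L[ℝ] ℝ) : VanishesOnKer l (a.compContinuousLinearMap l) := by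
  intro w i hi
  rw [ContinuousAlternatingMap.compContinuousLinearMap_apply]
  exact a.map_coord_zero i hi

theorem compContinuousLinearMap_injective_of_surjective {k : ℕ} {l : E →L[ℝ] E'}
    (hl : Surjective l) {a b : E' [⋀^Fin k]→L[ℝ] ℝ}
    (h : a.compContinuousLinearMap l = b.compContinuousLinearMap l) : a = b := by
  ext v
  choose w hw using fun i => hl (v i)
  have := congrArg (fun c => c w) h
  simpa [ContinuousAlternatingMap.compContinuousLinearMap_apply, comp_def, hw] using this

/-- A form of which the kernel directions of a surjective `l` are in the kernel is induced from
the target of `l`. -/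
theorem VanishesOnKer.exists_eq_comp [FiniteDimensional ℝ E'] {k : ℕ} {l : E →L[ℝ] E'}
    (hl : Surjective l) {a : E [⋀^Fin k]→L[ℝ] ℝ} (ha : VanishesOnKer l a) :
    ∃ b : E' [⋀^Fin k]→L[ℝ] ℝ, b.compContinuousLinearMap l = a := by
  -- Any linear right inverse serves, as `r (l w) - w` lies in the kernel of `l`.
  obtain ⟨r, hr⟩ := l.toLinearMap.exists_rightInverse_of_surjective (LinearMap.range_eq_top.2 hl)
  refine ⟨a.compContinuousLinearMap (LinearMap.toContinuousLinearMap r), ?_⟩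
  ext w
  refine ha.apply_eq fun i => ?_
  exact congrArg (fun f => f (l (w i))) hr

open ContinuousAlternatingMap in
/-- In a direction which is in the kernel of both a form and its exterior derivative, the form is
constant. -/
theorem fderiv_apply_eq_zero_of_vanishesOnKer {k : ℕ} {l : E →L[ℝ] E'}
    {α : E → E [⋀^Fin k]→L[ℝ] ℝ} {z : E} (hα : DifferentiableAt ℝ α z)
    (h : ∀ᶠ y in 𝓝 z, VanishesOnKer l (α y)) (hd : VanishesOnKer l (extDeriv α z)) {v : E}
    (hv : l v = 0) : fderiv ℝ α z v = 0 := by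
  ext w
  have h1 := hd (Fin.cons v w) 0 hv
  -- In the expansion of `dα(v, w)` every term but the derivative along `v` keeps `v` among the
  -- arguments of `α`, and so differentiates a function that vanishes near `z`.
  rw [extDeriv, alternatizeUncurryFin_apply, Fin.sum_univ_succ, Finset.sum_eq_zero] at h1
  · simpa using h1
  · intro j _
    let u : Fin k → E := Fin.removeNth j.succ (Fin.cons v w : Fin (k + 1) → E)
    have h2 : fderiv ℝ (ContinuousAlternatingMap.apply ℝ E ℝ u ∘ α) z =
        (ContinuousAlternatingMap.apply ℝ E ℝ u).comp (fderiv ℝ α z) :=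
      ((ContinuousAlternatingMap.apply ℝ E ℝ u).hasFDerivAt.comp z hα.hasFDerivAt).fderiv
    have h3 : (ContinuousAlternatingMap.apply ℝ E ℝ u ∘ α) =ᶠ[𝓝 z] fun _ => 0 := by
      filter_upwards [h] with y hy
      have : NeZero k := ⟨fun h => by subst h; exact j.elim0⟩
      refine hy _ 0 ?_
      have h4 : j.succ.succAbove 0 = 0 := Fin.succAbove_ne_zero_zero (Fin.succ_ne_zero j)
      change l ((Fin.cons v w : Fin (k + 1) → E) (j.succ.succAbove 0)) = 0
      rw [h4]
      exact hv
    have h5 := congrArg (fun f => f ((Fin.cons v w : Fin (k + 1) → E) j.succ)) (h2.symm.trans h3.fderiv_eq)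
    have h6 : fderiv ℝ α z ((Fin.cons v w : Fin (k + 1) → E) j.succ) u = 0 := by
      simpa using h5
    exact (congrArg _ h6).trans (smul_zero _)

/-- The segment from `x` to `y` stays in the convex set `U` and has direction in the kernel of `l`,
along which the derivative of `α` is zero. -/
theorem eq_of_vanishesOnKer {k : ℕ} {l : E →L[ℝ] E'} {α : E → E [⋀^Fin k]→L[ℝ] ℝ} {U : Set E}
    (hU : IsOpen U) (hc : Convex ℝ U) (hα : ∀ z ∈ U, DifferentiableAt ℝ α z)
    (h : ∀ z ∈ U, VanishesOnKer l (α z)) (hd : ∀ z ∈ U, VanishesOnKer l (extDeriv α z))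
    {x y : E} (hx : x ∈ U) (hy : y ∈ U) (hxy : l x = l y) : α x = α y := by
  have hmem (t : ℝ) (ht : t ∈ Icc (0 : ℝ) 1) : x + t • (y - x) ∈ U :=
    hc.add_smul_sub_mem hx hy ht
  have hder (t : ℝ) (ht : t ∈ Icc (0 : ℝ) 1) :
      HasDerivAt (fun t : ℝ => α (x + t • (y - x))) 0 t := by
    have h1 : HasDerivAt (fun t : ℝ => x + t • (y - x)) (y - x) t := by
      simpa using ((hasDerivAt_id t).smul_const (y - x)).const_add x
    have h2 := (hα _ (hmem t ht)).hasFDerivAt.comp_hasDerivAt t h1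
    rwa [fderiv_apply_eq_zero_of_vanishesOnKer (hα _ (hmem t ht))
      (Filter.eventually_of_mem (hU.mem_nhds (hmem t ht)) h) (hd _ (hmem t ht))
      (by rw [map_sub, hxy, sub_self])] at h2
  have := constant_of_has_deriv_right_zero
    (fun t ht => (hder t ht).continuousAt.continuousWithinAt)
    (fun t ht => (hder t (Ico_subset_Icc_self ht)).hasDerivWithinAt) 1 (by simp)
  simpa using this.symm

end Basic

/-! ### Descent of basic forms along a submersion -/

section Descent

variable {EP : Type*} [NormedAddCommGroup EP] [NormedSpace ℝ EP]
  {P : Type*} [TopologicalSpace P] [ChartedSpace EP P]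
  {ES : Type*} [NormedAddCommGroup ES] [NormedSpace ℝ ES]
  {S : Type*} [TopologicalSpace S] [ChartedSpace ES S]

/-- Charts in which a submersion is a linear projection. -/
theorem exists_charts_of_isSubmersion {f : P → S}
    (hf : Manifold.IsSubmersion 𝓘(ℝ, EP) 𝓘(ℝ, ES) ∞ f) (p : P) :
    ∃ (φ : OpenPartialHomeomorph P EP) (ψ : OpenPartialHomeomorph S ES) (l : EP →L[ℝ] ES)
      (r : ES →L[ℝ] EP), p ∈ φ.source ∧ f p ∈ ψ.source ∧
      ContMDiffOn 𝓘(ℝ, EP) 𝓘(ℝ, EP) ∞ φ φ.source ∧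
      ContMDiffOn 𝓘(ℝ, EP) 𝓘(ℝ, EP) ∞ φ.symm φ.target ∧
      ContMDiffOn 𝓘(ℝ, ES) 𝓘(ℝ, ES) ∞ ψ ψ.source ∧
      ContMDiffOn 𝓘(ℝ, ES) 𝓘(ℝ, ES) ∞ ψ.symm ψ.target ∧
      (∀ y, l (r y) = y) ∧ MapsTo f φ.source ψ.source ∧
      ∀ z ∈ φ.target, ψ (f (φ.symm z)) = l z := by
  obtain ⟨F, _, _, h⟩ := hf
  have hp := h p
  refine ⟨hp.domChart, hp.codChart,
    (ContinuousLinearMap.fst ℝ ES F).comp (hp.equiv : EP →L[ℝ] ES × F),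
    (hp.equiv.symm : ES × F →L[ℝ] EP).comp (ContinuousLinearMap.inl ℝ ES F),
    hp.mem_domChart_source, hp.mem_codChart_source,
    contMDiffOn_of_mem_maximalAtlas hp.domChart_mem_maximalAtlas,
    contMDiffOn_symm_of_mem_maximalAtlas hp.domChart_mem_maximalAtlas,
    contMDiffOn_of_mem_maximalAtlas hp.codChart_mem_maximalAtlas,
    contMDiffOn_symm_of_mem_maximalAtlas hp.codChart_mem_maximalAtlas,
    fun y => by simp, hp.mapsto_domChart_source_codChart_source, fun z hz => ?_⟩
  have := hp.writtenInCharts (show z ∈ (hp.domChart.extend 𝓘(ℝ, EP)).target by simpa using hz)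
  simpa using this

theorem tmap_comp_tmap_of_eventuallyEq_id {f : P → S} {s : S → P} {y : S}
    (hf : MDifferentiableAt 𝓘(ℝ, EP) 𝓘(ℝ, ES) f (s y))
    (hs : MDifferentiableAt 𝓘(ℝ, ES) 𝓘(ℝ, EP) s y) (h : ∀ᶠ y' in 𝓝 y, f (s y') = y') (v : ES) :
    tmap EP ES f (s y) (tmap ES EP s y v) = v := by
  rw [← tmap_comp_apply hf hs]
  exact tmap_of_eventuallyEq_id h v

theorem SmoothFormAt.congr {k : ℕ} {α β : DForm ES S k} {y : S} (hα : SmoothFormAt α y)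
    (h : β =ᶠ[𝓝 y] α) : SmoothFormAt β y := by
  refine ContDiffAt.congr_of_eventuallyEq hα ?_
  have hcont : Filter.Tendsto (extChartAt 𝓘(ℝ, ES) y).symm (𝓝 (extChartAt 𝓘(ℝ, ES) y y))
      (𝓝 y) := by
    simpa using (continuousAt_extChartAt_symm (I := 𝓘(ℝ, ES)) y).tendsto
  filter_upwards [hcont.eventually h] with z hz using pullback_apply_of_eq _ hz

variable [IsManifold 𝓘(ℝ, EP) ∞ P]

/-- Let `β` be a form on the total space of a submersion such that the vertical vectors are in the
kernels of `β` and of `dβ`. Near each point there is a local section along which `β` determines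
`β` on a neighbourhood. -/
theorem exists_section_of_isSubmersion [FiniteDimensional ℝ EP] {f : P → S}
    (hf : Manifold.IsSubmersion 𝓘(ℝ, EP) 𝓘(ℝ, ES) ∞ f) {k : ℕ} {β : DForm EP P k}
    (hβ : SmoothForm β) (h : ∀ q, VanishesOnKer (tmap EP ES f q) (β q))
    (hd : ∀ q, VanishesOnKer (tmap EP ES f q) (extD β q)) (p : P) :
    ∃ s : S → P, (∀ᶠ y in 𝓝 (f p), ContMDiffAt 𝓘(ℝ, ES) 𝓘(ℝ, EP) ∞ s y) ∧ s (f p) = p ∧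
      (∀ᶠ y in 𝓝 (f p), f (s y) = y) ∧
      ∀ᶠ q in 𝓝 p, ∀ b : ES [⋀^Fin k]→L[ℝ] ℝ,
        b.compContinuousLinearMap (tmap EP ES f (s (f q))) = β (s (f q)) →
          b.compContinuousLinearMap (tmap EP ES f q) = β q := by
  obtain ⟨φ, ψ, l, r, hp, hfp, hφ, hφs, hψ, hψs, hlr, hmaps, hloc⟩ :=
    exists_charts_of_isSubmersion hf p
  have hfs (q : P) : MDifferentiableAt 𝓘(ℝ, EP) 𝓘(ℝ, ES) f q :=
    hf.contMDiff.contMDiffAt.mdifferentiableAt (by simp)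
  have hφs' {z : EP} (hz : z ∈ φ.target) : ContMDiffAt 𝓘(ℝ, EP) 𝓘(ℝ, EP) ∞ φ.symm z :=
    hφs.contMDiffAt (φ.open_target.mem_nhds hz)
  have hψf {q : P} (hq : q ∈ φ.source) : ψ (f q) = l (φ q) := by
    rw [← hloc _ (φ.map_source hq), φ.left_inv hq]
  have hl {z : EP} (hz : z ∈ φ.target) : l z ∈ ψ.target := by
    rw [← hloc z hz]
    exact ψ.map_source (hmaps (φ.map_target hz))
  have hfφ {z : EP} (hz : z ∈ φ.target) : f (φ.symm z) = ψ.symm (l z) := by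
    rw [← hloc z hz, ψ.left_inv (hmaps (φ.map_target hz))]
  -- The chain rule applied to `hfφ`: in these charts the differential of `f` is `l`.
  have hT {z : EP} (hz : z ∈ φ.target) (v : EP) :
      tmap EP ES f (φ.symm z) (tmap EP EP φ.symm z v) = tmap ES ES ψ.symm (l z) (l v) := by
    have h1 : MDifferentiableAt 𝓘(ℝ, EP) 𝓘(ℝ, ES) l z := l.differentiableAt.mdifferentiableAt
    have h2 : MDifferentiableAt 𝓘(ℝ, ES) 𝓘(ℝ, ES) ψ.symm (l z) :=
      (hψs.contMDiffAt (ψ.open_target.mem_nhds (hl hz))).mdifferentiableAt (by simp)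
    have h3 : tmap EP ES l z v = l v := by
      unfold tmap
      rw [mfderiv_eq_fderiv]
      exact congrArg (fun A : EP →L[ℝ] ES => A v) l.fderiv
    rw [← tmap_comp_apply (hfs _) ((hφs' hz).mdifferentiableAt (by simp)), ← h3,
      ← tmap_comp_apply h2 h1]
    refine congrArg (fun A : EP →L[ℝ] ES => A v) (tmap_congr ?_)
    filter_upwards [φ.open_target.mem_nhds hz] with w hw using hfφ hw
  have hsurj {q : P} (hq : q ∈ φ.source) : Surjective (tmap EP EP φ.symm (φ q)) := by
    intro v
    have h1 : MDifferentiableAt 𝓘(ℝ, EP) 𝓘(ℝ, EP) φ.symm (φ q) :=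
      (hφs' (φ.map_source hq)).mdifferentiableAt (by simp)
    have h2 : MDifferentiableAt 𝓘(ℝ, EP) 𝓘(ℝ, EP) φ q :=
      (hφ.contMDiffAt (φ.open_source.mem_nhds hq)).mdifferentiableAt (by simp)
    exact ⟨tmap EP EP φ q v, tmap_comp_tmap_of_eventuallyEq_id h1 h2
      (Filter.eventually_of_mem (φ.open_source.mem_nhds hq) fun x hx => φ.left_inv hx) v⟩
  -- The affine right inverse of `l` through `φ p`; read through the charts it is the local section
  -- of `f`.
  let σ : ES → EP := fun y => φ p + r (y - l (φ p))
  have hσ : ContDiff ℝ ∞ σ := by fun_prop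
  have hlσ (y : ES) : l (σ y) = y := by simp [σ, hlr]
  have hσp : σ (ψ (f p)) = φ p := by simp [σ, hψf hp]
  have hσt : ∀ᶠ y in 𝓝 (f p), y ∈ ψ.source ∧ σ (ψ y) ∈ φ.target := by
    have h1 : ContinuousAt (fun y => σ (ψ y)) (f p) :=
      hσ.continuous.continuousAt.comp (ψ.continuousAt hfp)
    refine Filter.Eventually.and (ψ.open_source.mem_nhds hfp)
      (h1.eventually_mem (φ.open_target.mem_nhds ?_))
    rw [hσp]
    exact φ.map_source hp
  have hβs {z : EP} (hz : z ∈ φ.target) :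
      SmoothFormAt (pullback (E := EP) (M := EP) φ.symm β) z :=
    (hβ.smoothFormAt _).pullback (hφs' hz)
  have hvan {z : EP} (hz : z ∈ φ.target) {j : ℕ} {τ : DForm EP P j}
      (hτ : ∀ q, VanishesOnKer (tmap EP ES f q) (τ q)) :
      VanishesOnKer l (pullback (E := EP) (M := EP) φ.symm τ z) := by
    intro w i hi
    refine hτ (φ.symm z) (fun i => tmap EP EP φ.symm z (w i)) i ?_
    rw [hT hz, hi, map_zero]
  -- A ball supplies the convexity that `eq_of_vanishesOnKer` needs.
  obtain ⟨ε, hε, hball⟩ := Metric.isOpen_iff.1 φ.open_target (φ p) (φ.map_source hp)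
  refine ⟨fun y => φ.symm (σ (ψ y)), ?_, ?_, ?_, ?_⟩
  · filter_upwards [hσt] with y hy
    exact (hφs' hy.2).comp y (hσ.contMDiff.contMDiffAt.comp y
      (hψ.contMDiffAt (ψ.open_source.mem_nhds hy.1)))
  · simp only [hσp, φ.left_inv hp]
  · filter_upwards [hσt] with y hy
    rw [hfφ hy.2, hlσ, ψ.left_inv hy.1]
  · have h1 : ContinuousAt (fun q => σ (l (φ q))) p :=
      (hσ.continuous.comp l.continuous).continuousAt.comp (φ.continuousAt hp)
    have h2 : σ (l (φ p)) = φ p := by rw [← hψf hp, hσp]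
    filter_upwards [φ.open_source.mem_nhds hp,
      (φ.continuousAt hp).eventually_mem (Metric.ball_mem_nhds _ hε),
      h1.eventually_mem (by rw [h2]; exact Metric.ball_mem_nhds _ hε)] with q hq hq1 hq2 b hb
    rw [hψf hq] at hb
    have hz := φ.map_source hq
    have hz' := hball hq2
    have h3 : pullback (E := EP) (M := EP) φ.symm β (φ q) =
        pullback (E := EP) (M := EP) φ.symm β (σ (l (φ q))) := by
      refine eq_of_vanishesOnKer Metric.isOpen_ball (convex_ball (φ p) ε) (fun z hz => ?_)
        (fun z hz => hvan (hball hz) h) (fun z hz => ?_) hq1 hq2 (hlσ _).symm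
      · exact (smoothFormAt_self_iff.1 (hβs (hball hz))).differentiableAt (by simp)
      · rw [← extD_eq_extDeriv, extD_pullback (hβ.smoothFormAt _) (hφs' (hball hz))]
        exact hvan (hball hz) hd
    refine compContinuousLinearMap_injective_of_surjective (hsurj hq) ?_
    trans pullback (E := EP) (M := EP) φ.symm β (φ q)
    · rw [h3, pullback_apply, ← hb]
      ext v
      refine congrArg b (funext fun i => ?_)
      have h4 := hT hz (v i)
      rw [φ.left_inv hq] at h4
      refine h4.trans (Eq.trans ?_ (hT hz' (v i)).symm)
      rw [hlσ]
    · rw [pullback_apply, φ.left_inv hq]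

variable [IsManifold 𝓘(ℝ, ES) ∞ S]

/-- A form on the total space of a surjective submersion whose fibres are connected by curves is
the pull-back of a form on the base if the vertical vectors are in the kernels of the form and of
its exterior derivative. -/
theorem exists_eq_pullback_of_isSubmersion [FiniteDimensional ℝ EP] [FiniteDimensional ℝ ES]
    {f : P → S} (hf : Manifold.IsSubmersion 𝓘(ℝ, EP) 𝓘(ℝ, ES) ∞ f) (hsurj : Surjective f)
    (hconn : ∀ p q, f p = f q → ∃ (c : ℝ → P) (s t : ℝ), ContinuousOn c (Ioo s t) ∧
      (∀ u ∈ Ioo s t, f (c u) = f p) ∧ p ∈ c '' Ioo s t ∧ q ∈ c '' Ioo s t)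
    {k : ℕ} {β : DForm EP P k} (hβ : SmoothForm β)
    (h : ∀ q, VanishesOnKer (tmap EP ES f q) (β q))
    (hd : ∀ q, VanishesOnKer (tmap EP ES f q) (extD β q)) :
    ∃ α : DForm ES S k, SmoothForm α ∧ pullback f α = β := by
  have hfs (q : P) : MDifferentiableAt 𝓘(ℝ, EP) 𝓘(ℝ, ES) f q :=
    hf.contMDiff.contMDiffAt.mdifferentiableAt (by simp)
  have hT (p : P) : Surjective (tmap EP ES f p) := fun v => by
    obtain ⟨s, hs, hsp, hfs', -⟩ := exists_section_of_isSubmersion hf hβ h hd p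
    refine ⟨tmap ES EP s (f p) v, ?_⟩
    have := tmap_comp_tmap_of_eventuallyEq_id (hfs _)
      (hs.self_of_nhds.mdifferentiableAt (by simp)) hfs' v
    rwa [hsp] at this
  -- `D q` is the form on the tangent space at `f q` that induces `β q`, unique since the
  -- differential of `f` is onto. What must be shown is that it depends on `f q` alone.
  choose D hD using fun q => (h q).exists_eq_comp (hT q)
  have hloc (p : P) : ∀ᶠ q in 𝓝 p, f q = f p → D p = D q := by
    obtain ⟨s, -, hsp, -, hs⟩ := exists_section_of_isSubmersion hf hβ h hd p
    filter_upwards [hs] with q hq hqp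
    rw [hqp, hsp] at hq
    exact compContinuousLinearMap_injective_of_surjective (hT q) ((hq _ (hD p)).trans (hD q).symm)
  -- By `hloc`, `D` is locally constant on fibres, hence constant along a curve within a fibre.
  have hconst (p q : P) (hpq : f p = f q) : D p = D q := by
    obtain ⟨c, s, t, hc, hcf, ⟨u, hu, rfl⟩, ⟨v, hv, rfl⟩⟩ := hconn p q hpq
    refine isPreconnected_Ioo.induction₂ (fun u v => D (c u) = D (c v)) (fun u hu => ?_)
      (fun _ _ _ _ _ _ h1 h2 => h1.trans h2) (fun _ _ _ _ h => h.symm) hu hv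
    filter_upwards [(hc u hu).eventually (hloc (c u)), self_mem_nhdsWithin] with v hv hv'
    exact hv ((hcf v hv').trans (hcf u hu).symm)
  have hα (p : P) : D (surjInv hsurj (f p)) = D p := hconst _ _ (surjInv_eq hsurj _)
  refine ⟨fun y => D (surjInv hsurj y), SmoothForm.of_smoothFormAt fun y => ?_, ?_⟩
  · obtain ⟨p, rfl⟩ := hsurj y
    obtain ⟨s, hs, hsp, hfs', -⟩ := exists_section_of_isSubmersion hf hβ h hd p
    -- Near `f p` the descended form is the pull-back of `β` by the smooth section `s`.
    refine ((hβ.smoothFormAt _).pullback hs.self_of_nhds).congr ?_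
    filter_upwards [hs, hfs', hfs'.eventually_nhds] with y hy hy1 hy2
    have h1 := hα (s y)
    rw [hy1] at h1
    rw [h1, pullback_apply, ← hD (s y)]
    ext v
    refine congrArg (D (s y)) (funext fun i => ?_)
    exact (tmap_comp_tmap_of_eventuallyEq_id (hfs _) (hy.mdifferentiableAt (by simp)) hy2
      (v i)).symm
  · ext1 p
    rw [pullback_apply, hα, hD]

end Descent

/-! ### Contractions involving one-forms and forms with a one-dimensional kernel direction -/

section Linear

variable {E : Type*} [NormedAddCommGroup E] [NormedSpace ℝ E]
  {E' : Type*} [NormedAddCommGroup E'] [NormedSpace ℝ E']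

theorem covector_apply (a : E [⋀^Fin 1]→L[ℝ] ℝ) (x : E) : covector a x = a fun _ => x := rfl

theorem curryLeft_one_apply (a : E [⋀^Fin 1]→L[ℝ] ℝ) (x : E) (v : Fin 0 → E) :
    a.curryLeft x v = covector a x := by
  rw [covector_apply, ContinuousAlternatingMap.curryLeft_apply_apply]
  congr 1
  ext i
  rw [Subsingleton.elim i 0]
  rfl

theorem wedgeAlt_degree_zero_right {q : ℕ} (h : q + 0 = q) (b : E [⋀^Fin q]→L[ℝ] ℝ)
    (a : E [⋀^Fin 0]→L[ℝ] ℝ) : wedgeAlt h b a = a 0 • b := by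
  refine (eq_wedgeAlt_of_factorial_mul_eq h fun v => ?_).symm
  have hr : leftIdx h = id := by
    ext i
    simp [leftIdx]
  have h0 (σ : Equiv.Perm (Fin q)) : (v ∘ σ) ∘ rightIdx h = 0 := Subsingleton.elim _ _
  have h1 (σ : Equiv.Perm (Fin q)) :
      ((Equiv.Perm.sign σ : ℤ) : ℝ) * (b (v ∘ σ) * a 0) = a 0 * b v := by
    have h2 : b (v ∘ σ) = ((Equiv.Perm.sign σ : ℤ) : ℝ) * b v := by
      have := b.toAlternatingMap.map_perm v σ
      rw [Units.smul_def, zsmul_eq_mul] at this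
      exact this
    rw [h2]
    have h3 : ((Equiv.Perm.sign σ : ℤ) : ℝ) * ((Equiv.Perm.sign σ : ℤ) : ℝ) = 1 := by
      rcases Int.units_eq_one_or (Equiv.Perm.sign σ) with h | h <;> simp [h]
    linear_combination (b v * a 0) * h3
  simp only [hr, h0, comp_id, h1, ContinuousAlternatingMap.smul_apply, smul_eq_mul,
    Nat.factorial_zero, mul_one]
  simp [Fintype.card_perm]

/-- A kernel vector is a multiple of `x`, and whichever slot it occupies it can be moved to the
first at the cost of a sign. -/
theorem VanishesOnKer.of_curryLeft {k : ℕ} {l : E →L[ℝ] E'} {x : E}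
    (hl : ∀ v, l v = 0 → ∃ c : ℝ, c • x = v) {a : E [⋀^Fin (k + 1)]→L[ℝ] ℝ}
    (ha : a.curryLeft x = 0) : VanishesOnKer l a := by
  intro w i hi
  obtain ⟨c, hc⟩ := hl _ hi
  have h1 := a.neg_one_pow_smul_map_insertNth i (w i) (i.removeNth w)
  rw [Fin.insertNth_self_removeNth] at h1
  have h2 : a (Fin.cons (w i) (i.removeNth w)) = 0 := by
    change a.curryLeft (w i) (i.removeNth w) = 0
    rw [← hc, map_smul, ha, smul_zero]
    rfl
  refine (smul_eq_zero.1 (h1.trans h2)).resolve_left ?_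
  exact pow_ne_zero _ (by norm_num)

theorem vanishesOnKer_degree_zero (l : E →L[ℝ] E') (a : E [⋀^Fin 0]→L[ℝ] ℝ) :
    VanishesOnKer l a := fun _ i => i.elim0

theorem VanishesOnKer.curryLeft_eq_zero {k : ℕ} {l : E →L[ℝ] E'} {x : E} (hx : l x = 0)
    {a : E [⋀^Fin (k + 1)]→L[ℝ] ℝ} (ha : VanishesOnKer l a) : a.curryLeft x = 0 := by
  ext v
  exact ha (Fin.cons x v) 0 hx

/-- Contracting twice with `x` gives zero. This is why, in contractions of `θ ∧ π^* ζ` and `dθ ∧ π^*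
ζ` with `X'`, nothing falls on `π^* ζ`. -/
theorem curryWedgeRight_smul_curryLeft {p q r : ℕ} (h : p + q = r + 1) (a : E [⋀^Fin p]→L[ℝ] ℝ)
    (c : ℝ) (b : E [⋀^Fin (q + 1)]→L[ℝ] ℝ) (x : E) :
    curryWedgeRight h a (c • b.curryLeft x) x = 0 := by
  cases q with
  | zero => rfl
  | succ q =>
    have h1 : (c • b.curryLeft x).curryLeft x = 0 := by
      ext v
      have : b.curryLeft x (Fin.cons x v) = 0 :=
        b.map_eq_zero_of_eq (Fin.cons x (Fin.cons x v)) (i := 0) (j := 1) rfl (by simp)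
      exact (congrArg (c • ·) this).trans (smul_zero c)
    rw [curryWedgeRight, h1, wedgeAlt_zero_right]

theorem curryLeft_wedgeAlt_one {k : ℕ} (h : 1 + k = k + 1) (a : E [⋀^Fin 1]→L[ℝ] ℝ)
    (b : E [⋀^Fin k]→L[ℝ] ℝ) (x : E) :
    (wedgeAlt h a b).curryLeft x = covector a x • b - curryWedgeRight h a b x := by
  have h1 : curryWedgeLeft h a b x = covector a x • b := by
    rw [← curryLeft_one_apply a x 0]
    exact wedgeAlt_degree_zero_left (Nat.zero_add k) (a.curryLeft x) b
  rw [curryLeft_wedgeAlt, h1]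
  module

theorem curryWedgeRight_comp_eq_zero {p q r : ℕ} (h : p + q = r + 1) {a : E [⋀^Fin p]→L[ℝ] ℝ}
    (b : E [⋀^Fin q]→L[ℝ] ℝ) (x : E) {f : E' →L[ℝ] E} (ha : a.compContinuousLinearMap f = 0) :
    (curryWedgeRight h a b x).compContinuousLinearMap f = 0 := by
  cases q with
  | zero => rfl
  | succ q =>
    rw [curryWedgeRight, wedgeAlt_compContinuousLinearMap, ha, wedgeAlt_zero_left]

/-- The interior product of `a ∧ b` for one-forms `a`, `b`. -/
theorem curryLeft_wedgeAlt_one_one (h : 1 + 1 = 2) (a b : E [⋀^Fin 1]→L[ℝ] ℝ) (x : E) :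
    (wedgeAlt h a b).curryLeft x = covector a x • b - covector b x • a := by
  refine (curryLeft_wedgeAlt_one h a b x).trans ?_
  congr 1
  rw [← curryLeft_one_apply b x 0]
  exact wedgeAlt_degree_zero_right (Nat.add_zero 1) a (b.curryLeft x)

end Linear

/-! ### Restriction to horizontal vectors -/

section Horizontal

variable {EP : Type*} [NormedAddCommGroup EP] [NormedSpace ℝ EP] {P : Type*}

/-- The restriction of an alternating form to the horizontal space. -/
def hrestrict (θ : DForm EP P 1) (p : P) {k : ℕ} :
    (EP [⋀^Fin k]→L[ℝ] ℝ) →ₗ[ℝ] (horizontal θ p) [⋀^Fin k]→L[ℝ] ℝ where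
  toFun a := a.compContinuousLinearMap (horizontal θ p).subtypeL
  map_add' _ _ := rfl
  map_smul' _ _ := rfl

theorem hrestrict_wedgeAlt (θ : DForm EP P 1) (p : P) {j k l : ℕ} (h : j + k = l)
    (a : EP [⋀^Fin j]→L[ℝ] ℝ) (b : EP [⋀^Fin k]→L[ℝ] ℝ) :
    hrestrict θ p (wedgeAlt h a b) = wedgeAlt h (hrestrict θ p a) (hrestrict θ p b) :=
  wedgeAlt_compContinuousLinearMap h a b _

theorem hrestrict_self (θ : DForm EP P 1) (p : P) : hrestrict θ p (θ p) = 0 := by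
  ext v
  have h1 : (fun i => ((v i : horizontal θ p) : EP)) = fun _ => ((v 0 : horizontal θ p) : EP) := by
    ext i
    rw [Subsingleton.elim i 0]
  have h2 : covector (θ p) (v 0 : EP) = 0 := (v 0).2
  exact (congrArg (θ p) h1).trans h2

theorem hrestrict_eq_iff {θ : DForm EP P 1} {p : P} {k : ℕ} {a b : EP [⋀^Fin k]→L[ℝ] ℝ} :
    hrestrict θ p a = hrestrict θ p b ↔
      ∀ v : Fin k → EP, (∀ i, v i ∈ horizontal θ p) → a v = b v := by
  refine ⟨fun h v hv => ?_, fun h => ?_⟩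
  · exact congrArg (fun c => c fun i => ⟨v i, hv i⟩) h
  · ext v
    exact h _ fun i => (v i).2

end Horizontal

/-! ### Relatedness through horizontal restriction, and the bundle projection -/

section Shear

variable {E : Type*} [NormedAddCommGroup E] [NormedSpace ℝ E]
  {M : Type*} [TopologicalSpace M] [ChartedSpace E M]
  {EP : Type*} [NormedAddCommGroup EP] [NormedSpace ℝ EP]
  {P : Type*} [TopologicalSpace P] [ChartedSpace EP P]
  {ES : Type*} [NormedAddCommGroup ES] [NormedSpace ℝ ES]
  {S : Type*} [TopologicalSpace S] [ChartedSpace ES S]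

theorem hRelated_iff {k : ℕ} {π : P → M} {θ : DForm EP P 1} {πS : P → S} {α : DForm E M k}
    {αS : DForm ES S k} : HRelated π θ πS α αS ↔
      ∀ p, hrestrict θ p (pullback π α p) = hrestrict θ p (pullback πS αS p) :=
  forall_congr' fun _ => hrestrict_eq_iff.symm

section Bundle

variable {EL : Type*} [NormedAddCommGroup EL] [NormedSpace ℝ EL]
  {L : Type*} [TopologicalSpace L] [ChartedSpace EL L] {π : P → M}

theorem IsSmoothFibreBundle.contMDiff (h : IsSmoothFibreBundle (E := EP) (E' := E) (EL := EL) L π) :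
    ContMDiff 𝓘(ℝ, EP) 𝓘(ℝ, E) ∞ π := by
  intro p
  obtain ⟨e, hx, he, -⟩ := h (π p)
  have hp : p ∈ e.source := e.mem_source.2 hx
  refine (he.contMDiffAt (e.open_source.mem_nhds hp)).fst.congr_of_eventuallyEq ?_
  filter_upwards [e.open_source.mem_nhds hp] with q hq using (e.coe_fst hq).symm

theorem IsSmoothFibreBundle.surjective [Nonempty L]
    (h : IsSmoothFibreBundle (E := EP) (E' := E) (EL := EL) L π) : Surjective π := fun x => by
  obtain ⟨e, hx, -, -⟩ := h x
  obtain ⟨l⟩ := ‹Nonempty L›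
  exact ⟨_, e.proj_symm_apply (x := (x, l)) (e.mem_target.2 hx)⟩

theorem IsSmoothFibreBundle.tmap_surjective
    (h : IsSmoothFibreBundle (E := EP) (E' := E) (EL := EL) L π) (p : P) :
    Surjective (tmap EP E π p) := fun v => by
  obtain ⟨e, hx, -, he⟩ := h (π p)
  have hp : p ∈ e.source := e.mem_source.2 hx
  -- The local section through `p` with constant fibre coordinate; its differential inverts that of
  -- `π` from the right.
  let s : M → P := fun y => e.toOpenPartialHomeomorph.symm (y, (e p).2)
  have hs : ContMDiffAt 𝓘(ℝ, E) 𝓘(ℝ, EP) ∞ s (π p) :=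
    (he.contMDiffAt (x := (π p, (e p).2)) (e.open_target.mem_nhds (e.mem_target.2 hx))).comp (π p)
      (contMDiffAt_id.prodMk contMDiffAt_const)
  have hsp : s (π p) = p := by
    have h1 : (π p, (e p).2) = e p := Prod.ext (e.coe_fst hp).symm rfl
    change e.toOpenPartialHomeomorph.symm (π p, (e p).2) = p
    rw [h1]
    exact e.left_inv hp
  have hπs : ∀ᶠ y in 𝓝 (π p), π (s y) = y := by
    filter_upwards [e.open_baseSet.mem_nhds hx] with y hy
    exact e.proj_symm_apply (e.mem_target.2 hy)
  have := tmap_comp_tmap_of_eventuallyEq_id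
    (h.contMDiff.contMDiffAt.mdifferentiableAt (by simp)) (hs.mdifferentiableAt (by simp)) hπs v
  rw [hsp] at this
  exact ⟨_, this⟩

end Bundle

end Shear

/-- The value of a vector field, as a vector in the model space. -/
def fieldAt {E : Type*} [NormedAddCommGroup E] [NormedSpace ℝ E] {M : Type*} [TopologicalSpace M]
    [ChartedSpace E M] (X : VField E M) (x : M) : E := X x

/-! ### The defect of the automorphic condition -/

section Defect

variable {E : Type*} [NormedAddCommGroup E] [NormedSpace ℝ E] [FiniteDimensional ℝ E]
  {M : Type*} [TopologicalSpace M] [ChartedSpace E M] [IsManifold 𝓘(ℝ, E) ∞ M]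

/-- The form `L_X α - γ ∧ (X ⌟ α)`, which vanishes when `α` is automorphic. -/
def automorphicDefect (X : VField E M) (F : DForm E M 2) (η : DForm E M 1) (a : M → ℝ) :
    {k : ℕ} → DForm E M k → DForm E M k
  | 0, α => lieD X α
  | k + 1, α => lieD X α - wedge (Nat.add_comm 1 k) (gammaForm X F η a) (interior X α)

omit [FiniteDimensional ℝ E] [IsManifold 𝓘(ℝ, E) ∞ M] in
theorem automorphic_iff {X : VField E M} {F : DForm E M 2} {η : DForm E M 1} {a : M → ℝ} {k : ℕ}
    {α : DForm E M k} : Automorphic X F η a α ↔ automorphicDefect X F η a α = 0 := by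
  cases k with
  | zero => rfl
  | succ k => exact sub_eq_zero.symm

/-- The form `a⁻¹ (X ⌟ α)`. -/
def scaledInterior (X : VField E M) (a : M → ℝ) {k : ℕ} (α : DForm E M (k + 1)) : DForm E M k :=
  fmul a⁻¹ (interior X α)

theorem SmoothForm.scaledInterior {X : VField E M} (hX : SmoothFieldOn X univ) {a : M → ℝ}
    (ha : ContMDiff 𝓘(ℝ, E) 𝓘(ℝ, ℝ) ∞ a⁻¹) {k : ℕ} {α : DForm E M (k + 1)} (hα : SmoothForm α) :
    SmoothForm (scaledInterior X a α) :=
  (hα.interior hX).fmul ha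

/-- Write `X ⌟ α = a ζ` in Cartan's formula. The term `da ∧ ζ` of `d(a ζ)` cancels against the `a⁻¹
da` in `γ`, so no derivative of `a` itself is left. -/
theorem automorphicDefect_succ_apply {X : VField E M} (hX : SmoothFieldOn X univ)
    (F : DForm E M 2) (η : DForm E M 1) {a : M → ℝ} (ha : ContMDiff 𝓘(ℝ, E) 𝓘(ℝ, ℝ) ∞ a)
    (ha' : ContMDiff 𝓘(ℝ, E) 𝓘(ℝ, ℝ) ∞ a⁻¹) (ha0 : ∀ x, a x ≠ 0) {k : ℕ}
    {α : DForm E M (k + 1)} (hα : SmoothForm α) (x : M) :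
    automorphicDefect X F η a α x = (extD α x).curryLeft (fieldAt X x) +
      a x • extD (scaledInterior X a α) x +
      a x • wedgeAlt (Nat.add_comm 1 k) (η x) (scaledInterior X a α x) -
      wedgeAlt (Nat.add_comm 1 k) ((F x).curryLeft (fieldAt X x)) (scaledInterior X a α x) := by
  set ζ := scaledInterior X a α with hζ
  have h1 : interior X α = fmul a ζ := by
    ext1 y
    exact (smul_inv_smul₀ (ha0 y) _).symm
  have h2 : extD (interior X α) x =
      wedgeAlt (Nat.add_comm 1 k) (extD (ofFun E a) x) (ζ x) + a x • extD ζ x := by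
    have h3 := extD_wedge (Nat.zero_add k) (SmoothForm.ofFun ha) (hα.scaledInterior hX ha')
    rw [wedge_ofFun_left, ← hζ, ← h1, pow_zero, one_smul] at h3
    have h4 := congrFun (wedge_ofFun_left (Nat.zero_add (k + 1)) a (extD ζ)) x
    exact (congrFun h3 x).trans (congrArg (wedgeAlt (Nat.add_comm 1 k) (extD (ofFun E a) x) (ζ x) + ·)
      h4)
  have h5 : wedgeAlt (Nat.add_comm 1 k) (gammaForm X F η a x) (interior X α x) =
      wedgeAlt (Nat.add_comm 1 k) (extD (ofFun E a) x) (ζ x) +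
      wedgeAlt (Nat.add_comm 1 k) ((F x).curryLeft (fieldAt X x)) (ζ x) -
      a x • wedgeAlt (Nat.add_comm 1 k) (η x) (ζ x) := by
    rw [h1]
    change wedgeAlt _ ((a x)⁻¹ • (extD (ofFun E a) x + (F x).curryLeft (fieldAt X x)) - η x)
      (a x • ζ x) = _
    rw [wedgeAlt_smul_right, wedgeAlt_sub_left, wedgeAlt_smul_left, wedgeAlt_add_left, smul_sub,
      smul_inv_smul₀ (ha0 x)]
  change lieD X α x - wedgeAlt (Nat.add_comm 1 k) (gammaForm X F η a x) (interior X α x) = _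
  rw [h5, lieD_succ hX hα]
  change (extD α x).curryLeft (fieldAt X x) + extD (interior X α) x - _ = _
  rw [h2]
  abel

end Defect

/-! ### The lift of a form to `P` that is annihilated by `X'` -/

section Shear

variable {E : Type*} [NormedAddCommGroup E] [NormedSpace ℝ E]
  {M : Type*} [TopologicalSpace M] [ChartedSpace E M] [IsManifold 𝓘(ℝ, E) ∞ M]
  {EP : Type*} [NormedAddCommGroup EP] [NormedSpace ℝ EP]
  {P : Type*} [TopologicalSpace P] [ChartedSpace EP P] [IsManifold 𝓘(ℝ, EP) ∞ P]
  {ES : Type*} [NormedAddCommGroup ES] [NormedSpace ℝ ES]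
  {S : Type*} [TopologicalSpace S] [ChartedSpace ES S]
  {EL : Type*} [NormedAddCommGroup EL] [NormedSpace ℝ EL]
  {L : Type*} [TopologicalSpace L] [ChartedSpace EL L]
  {X : VField E M} {F : DForm E M 2} {η : DForm E M 1} {a : M → ℝ}
  {π : P → M} {θ : DForm EP P 1} {X' : VField EP P} {πS : P → S}

/-- The form `π^* α - θ ∧ π^* (a⁻¹ (X ⌟ α))` on `P`, which agrees with `π^* α` on the horizontal
vectors and has `X'` in its kernel. -/
def shearLift (X : VField E M) (a : M → ℝ) (π : P → M) (θ : DForm EP P 1) :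
    {k : ℕ} → DForm E M k → DForm EP P k
  | 0, α => pullback π α
  | k + 1, α => pullback π α -
      wedge (Nat.add_comm 1 k) θ (pullback (E := EP) π (scaledInterior X a α))

theorem pullback_smooth [FiniteDimensional ℝ EP] {f : P → M} (hf : ContMDiff 𝓘(ℝ, EP) 𝓘(ℝ, E) ∞ f) {k : ℕ}
    {α : DForm E M k} (hα : SmoothForm α) : SmoothForm (pullback (E := EP) f α) :=
  SmoothForm.of_smoothFormAt fun _ => (hα.smoothFormAt _).pullback hf.contMDiffAt

theorem extD_pullback_eq [FiniteDimensional ℝ EP] {f : P → M} (hf : ContMDiff 𝓘(ℝ, EP) 𝓘(ℝ, E) ∞ f) {k : ℕ}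
    {α : DForm E M k} (hα : SmoothForm α) :
    extD (pullback (E := EP) f α) = pullback f (extD α) := by
  ext1 p
  exact extD_pullback (hα.smoothFormAt _) hf.contMDiffAt

omit [IsManifold 𝓘(ℝ, E) ∞ M] [IsManifold 𝓘(ℝ, EP) ∞ P] in
theorem hrestrict_shearLift {k : ℕ} (α : DForm E M k) (p : P) :
    hrestrict θ p (shearLift X a π θ α p) = hrestrict θ p (pullback π α p) := by
  cases k with
  | zero => rfl
  | succ k =>
    change hrestrict θ p (pullback π α p - wedgeAlt (Nat.add_comm 1 k) (θ p)
      (pullback (E := EP) π (scaledInterior X a α) p)) = _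
    rw [map_sub, hrestrict_wedgeAlt, hrestrict_self, wedgeAlt_zero_left, sub_zero]

namespace IsShear

variable (h : IsShear (ES := ES) (EL := EL) L X F η a π θ X' πS)
include h

theorem contMDiff_inv : ContMDiff 𝓘(ℝ, E) 𝓘(ℝ, ℝ) ∞ a⁻¹ :=
  h.smooth_a.inv₀ h.a_ne_zero

theorem contMDiff_projection : ContMDiff 𝓘(ℝ, EP) 𝓘(ℝ, E) ∞ π := h.bundle.contMDiff

theorem contMDiff_shear_projection : ContMDiff 𝓘(ℝ, EP) 𝓘(ℝ, ES) ∞ πS := h.submersion.contMDiff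

theorem tmap_X' (p : P) : tmap EP E π p (fieldAt X' p) = fieldAt X (π p) := h.lift_X p

theorem tmap_shear_X' (p : P) : tmap EP ES πS p (fieldAt X' p) = 0 := by
  have h1 : fieldAt X' p ∈ vertical (EP := EP) (E := ES) πS p := by
    rw [h.vertical_πS]
    exact Submodule.mem_span_singleton_self _
  exact h1

theorem exists_smul_X' (p : P) (v : EP) (hv : tmap EP ES πS p v = 0) :
    ∃ c : ℝ, c • fieldAt X' p = v := by
  have h1 : v ∈ vertical (EP := EP) (E := ES) πS p := hv
  rw [h.vertical_πS] at h1
  exact Submodule.mem_span_singleton.1 h1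

/-- A form which descends to the shear is determined by its values on horizontal vectors. -/
theorem eq_of_hrestrict_eq {p : P} {k : ℕ} {b c : EP [⋀^Fin k]→L[ℝ] ℝ}
    (hb : VanishesOnKer (tmap EP ES πS p) b) (hc : VanishesOnKer (tmap EP ES πS p) c)
    (hbc : hrestrict θ p b = hrestrict θ p c) : b = c := by
  obtain ⟨x, hx, hx'⟩ : ∃ x : EP, tmap EP ES πS p x = 0 ∧ covector (θ p) x = a (π p) :=
    ⟨fieldAt X' p, h.tmap_shear_X' p, h.θ_X' p⟩
  ext w
  -- Projection to the horizontal space along `X'`; the coefficient is forced by `θ(X') = a`.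
  let w' : Fin k → EP := fun i => w i - ((a (π p))⁻¹ * covector (θ p) (w i)) • x
  have h1 (i : Fin k) : tmap EP ES πS p (w i) = tmap EP ES πS p (w' i) := by
    rw [map_sub, map_smul, hx, smul_zero, sub_zero]
  have h2 (i : Fin k) : w' i ∈ horizontal θ p := by
    change covector (θ p) (w' i) = 0
    have := h.a_ne_zero (π p)
    rw [map_sub, map_smul, hx', smul_eq_mul]
    field_simp
    ring
  rw [hb.apply_eq h1, hc.apply_eq h1]
  exact hrestrict_eq_iff.1 hbc w' h2

theorem exists_horizontal (p : P) (u : E) : ∃ v ∈ horizontal θ p, tmap EP E π p v = u := by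
  obtain ⟨w, rfl⟩ := h.bundle.tmap_surjective p u
  have h1 : w ∈ horizontal θ p ⊔ vertical (E := E) π p := by
    rw [(h.transverse p).sup_eq_top]
    trivial
  obtain ⟨v, hv, v', hv', rfl⟩ := Submodule.mem_sup.1 h1
  have h2 : tmap EP E π p v' = 0 := hv'
  exact ⟨v, hv, by rw [map_add, h2, add_zero]⟩

/-- Horizontal vectors map onto the tangent spaces of `M`, and a nonempty fibre makes `π`
surjective, so nothing is lost on passing to `P`. -/
theorem eq_of_hrestrict_pullback_eq [Nonempty L] {k : ℕ} {α β : DForm E M k}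
    (hαβ : ∀ p, hrestrict θ p (pullback π α p) = hrestrict θ p (pullback π β p)) : α = β := by
  ext1 x
  obtain ⟨p, rfl⟩ := h.bundle.surjective x
  ext u
  choose v hv hvu using fun i => h.exists_horizontal p (u i)
  have h1 : α (π p) (fun i => tmap EP E π p (v i)) = β (π p) (fun i => tmap EP E π p (v i)) :=
    hrestrict_eq_iff.1 (hαβ p) v hv
  simpa only [hvu] using h1

theorem smooth_shearLift [FiniteDimensional ℝ E] [FiniteDimensional ℝ EP] {k : ℕ} {α : DForm E M k} (hα : SmoothForm α) :
    SmoothForm (shearLift X a π θ α) := by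
  cases k with
  | zero => exact pullback_smooth h.contMDiff_projection hα
  | succ k =>
    exact (pullback_smooth h.contMDiff_projection hα).sub (h.smooth_θ.wedge _
      (pullback_smooth h.contMDiff_projection (hα.scaledInterior h.smooth_X h.contMDiff_inv)))

theorem pullback_scaledInterior {k : ℕ} (α : DForm E M (k + 1)) (p : P) :
    pullback (E := EP) π (scaledInterior X a α) p =
      (a (π p))⁻¹ • (pullback (E := EP) π α p).curryLeft (fieldAt X' p) := by
  rw [curryLeft_pullback, h.tmap_X']
  rfl

/-- The factor `θ(X') = a` cancels the `a⁻¹` in `ζ`, so the correction term contributes exactly `π^*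
(X ⌟ α)`. -/
theorem curryLeft_shearLift {k : ℕ} (α : DForm E M (k + 1)) (p : P) :
    (shearLift X a π θ α p).curryLeft (fieldAt X' p) = 0 := by
  have h1 : covector (θ p) (fieldAt X' p) = a (π p) := h.θ_X' p
  change (pullback (E := EP) π α p).curryLeft (fieldAt X' p) - (wedgeAlt (Nat.add_comm 1 k) (θ p)
    (pullback (E := EP) π (scaledInterior X a α) p)).curryLeft (fieldAt X' p) = 0
  rw [curryLeft_wedgeAlt_one, h.pullback_scaledInterior, curryWedgeRight_smul_curryLeft, h1,
    smul_inv_smul₀ (h.a_ne_zero _), sub_zero, sub_self]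

theorem vanishesOnKer_shearLift {k : ℕ} (α : DForm E M k) (p : P) :
    VanishesOnKer (tmap EP ES πS p) (shearLift X a π θ α p) := by
  cases k with
  | zero => exact vanishesOnKer_degree_zero _ _
  | succ k => exact VanishesOnKer.of_curryLeft (h.exists_smul_X' p) (h.curryLeft_shearLift α p)

/-- Both forms are annihilated by the kernel of the differential of `πS`, and such forms are
determined by their horizontal restrictions. A condition on horizontal vectors thus becomes an
equation on `P`, which can be differentiated. -/
theorem hRelated_iff_pullback_eq {k : ℕ} {α : DForm E M k} {αS : DForm ES S k} :
    HRelated π θ πS α αS ↔ pullback πS αS = shearLift X a π θ α := by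
  rw [hRelated_iff]
  refine ⟨fun h1 => ?_, fun h1 p => ?_⟩
  · ext1 p
    refine h.eq_of_hrestrict_eq (vanishesOnKer_compContinuousLinearMap _ _)
      (h.vanishesOnKer_shearLift α p) ?_
    rw [hrestrict_shearLift, h1]
  · rw [h1, hrestrict_shearLift]

end IsShear
end Shear

/-! ### The differential of the lift -/

section ShearCalculus

variable {E : Type*} [NormedAddCommGroup E] [NormedSpace ℝ E] [FiniteDimensional ℝ E]
  {M : Type*} [TopologicalSpace M] [ChartedSpace E M] [IsManifold 𝓘(ℝ, E) ∞ M]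
  {EP : Type*} [NormedAddCommGroup EP] [NormedSpace ℝ EP] [FiniteDimensional ℝ EP]
  {P : Type*} [TopologicalSpace P] [ChartedSpace EP P] [IsManifold 𝓘(ℝ, EP) ∞ P]
  {ES : Type*} [NormedAddCommGroup ES] [NormedSpace ℝ ES]
  {S : Type*} [TopologicalSpace S] [ChartedSpace ES S]
  {EL : Type*} [NormedAddCommGroup EL] [NormedSpace ℝ EL]
  {L : Type*} [TopologicalSpace L] [ChartedSpace EL L]
  {X : VField E M} {F : DForm E M 2} {η : DForm E M 1} {a : M → ℝ}
  {π : P → M} {θ : DForm EP P 1} {X' : VField EP P} {πS : P → S}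

namespace IsShear

theorem extD_shearLift_succ_apply (h : IsShear (ES := ES) (EL := EL) L X F η a π θ X' πS) {k : ℕ}
    {α : DForm E M (k + 1)} (hα : SmoothForm α) (p : P) :
    extD (shearLift X a π θ α) p = pullback π (extD α) p -
      wedgeAlt (show 1 + 1 + k = k + 2 by omega) (extD θ p)
        (pullback (E := EP) π (scaledInterior X a α) p) +
      wedgeAlt (show 1 + (k + 1) = k + 2 by omega) (θ p)
        (pullback π (extD (scaledInterior X a α)) p) := by
  have h1 := hα.scaledInterior h.smooth_X h.contMDiff_inv
  have h2 := pullback_smooth h.contMDiff_projection h1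
  have h3 : extD (shearLift X a π θ α) = extD (pullback (E := EP) π α) -
      extD (wedge (Nat.add_comm 1 k) θ (pullback (E := EP) π (scaledInterior X a α))) :=
    extD_sub (pullback_smooth h.contMDiff_projection hα) (h.smooth_θ.wedge _ h2)
  rw [h3, extD_wedge _ h.smooth_θ h2, extD_pullback_eq h.contMDiff_projection hα,
    extD_pullback_eq h.contMDiff_projection h1]
  change pullback π (extD α) p - (wedgeAlt (show 1 + 1 + k = k + 2 by omega) (extD θ p)
        (pullback (E := EP) π (scaledInterior X a α) p) +
      (-1 : ℝ) ^ 1 • wedgeAlt (show 1 + (k + 1) = k + 2 by omega) (θ p)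
        (pullback π (extD (scaledInterior X a α)) p)) = _
  module

/-- On horizontal vectors, the exterior derivative on `P` is the shear differential. -/
theorem hrestrict_extD_shearLift (h : IsShear (ES := ES) (EL := EL) L X F η a π θ X' πS) {k : ℕ}
    {α : DForm E M k} (hα : SmoothForm α) (p : P) :
    hrestrict θ p (extD (shearLift X a π θ α) p) =
      hrestrict θ p (pullback π (shearD X F a α) p) := by
  cases k with
  | zero => exact congrArg _ (congrFun (extD_pullback_eq h.contMDiff_projection hα) p)
  | succ k =>
    -- `θ` vanishes on horizontal vectors, so only the curvature part of `dθ` survives.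
    have h1 : hrestrict θ p (extD θ p) = hrestrict θ p (pullback π F p) := by
      rw [h.d_θ]
      change hrestrict θ p (wedgeAlt _ (pullback π η p) (θ p) + pullback π F p) = _
      rw [map_add, hrestrict_wedgeAlt, hrestrict_self, wedgeAlt_zero_right, zero_add]
    have h2 : pullback (E := EP) π (shearD X F a α) p = pullback π (extD α) p -
        wedgeAlt (show 1 + 1 + k = k + 2 by omega) (pullback π F p)
          (pullback (E := EP) π (scaledInterior X a α) p) := by
      have h3 := congrFun (pullback_wedge (E := EP) (Nat.add_comm 2 k) π F (interior X α)) p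
      change pullback π (extD α) p -
        (a (π p))⁻¹ • pullback (E := EP) π (wedge (Nat.add_comm 2 k) F (interior X α)) p = _
      rw [h3]
      refine congrArg (pullback π (extD α) p - ·) ?_
      exact (wedgeAlt_smul_right _ _ _ _).symm
    rw [h.extD_shearLift_succ_apply hα, h2, map_add, map_sub, map_sub, hrestrict_wedgeAlt,
      hrestrict_wedgeAlt, hrestrict_self, h1, wedgeAlt_zero_left, add_zero, hrestrict_wedgeAlt]

-- Contract `dθ = π^* η ∧ θ + π^* F` with `X'`, using `η(X) = 0` and `θ(X') = a`. This is the origin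
-- of `ν` and `η` in `γ`.
omit [FiniteDimensional ℝ E] [FiniteDimensional ℝ EP] in
theorem hrestrict_curryLeft_extD_θ (h : IsShear (ES := ES) (EL := EL) L X F η a π θ X' πS)
    (p : P) : hrestrict θ p ((extD θ p).curryLeft (fieldAt X' p)) =
      hrestrict θ p (pullback (E := EP) π (interior X F) p) -
        a (π p) • hrestrict θ p (pullback π η p) := by
  have h1 : covector (pullback (E := EP) π η p) (fieldAt X' p) = 0 := by
    refine Eq.trans ?_ (h.η_X (π p))
    exact congrArg (covector (η (π p))) (h.tmap_X' p)
  have h2 : covector (θ p) (fieldAt X' p) = a (π p) := h.θ_X' p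
  have h3 : (pullback (E := EP) π F p).curryLeft (fieldAt X' p) =
      pullback (E := EP) π (interior X F) p := by
    rw [curryLeft_pullback, h.tmap_X']
    rfl
  have h4 : (extD θ p).curryLeft (fieldAt X' p) =
      (wedgeAlt (by norm_num : 1 + 1 = 2) (pullback π η p) (θ p)).curryLeft (fieldAt X' p) +
        (pullback (E := EP) π F p).curryLeft (fieldAt X' p) := by
    rw [h.d_θ]
    rfl
  rw [h4, h3, curryLeft_wedgeAlt_one_one, h1, h2, zero_smul, zero_sub, map_add, map_neg, map_smul]
  abel

/-- On horizontal vectors, the interior product of `X'` with the exterior derivative measures the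
failure of the automorphic condition. -/
theorem hrestrict_curryLeft_extD_shearLift
    (h : IsShear (ES := ES) (EL := EL) L X F η a π θ X' πS) {k : ℕ}
    {α : DForm E M k} (hα : SmoothForm α) (p : P) :
    hrestrict θ p ((extD (shearLift X a π θ α) p).curryLeft (fieldAt X' p)) =
      hrestrict θ p (pullback π (automorphicDefect X F η a α) p) := by
  have hc {j : ℕ} (β : DForm E M (j + 1)) :
      (pullback (E := EP) π β p).curryLeft (fieldAt X' p) =
        pullback (E := EP) π (interior X β) p := by
    rw [curryLeft_pullback, h.tmap_X']
    rfl
  cases k with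
  | zero =>
    have h1 : extD (shearLift X a π θ α) p = pullback π (extD α) p :=
      congrFun (extD_pullback_eq h.contMDiff_projection hα) p
    rw [h1, hc, ← lieD_zero]
    rfl
  | succ k =>
    have hθ : covector (θ p) (fieldAt X' p) = a (π p) := h.θ_X' p
    set Ω := pullback (E := EP) π (scaledInterior X a α) p with hΩ
    set dΩ := pullback (E := EP) π (extD (scaledInterior X a α)) p with hdΩ
    -- `Ω` is itself a multiple of a contraction with `X'`, so only `dθ` is contracted.
    have h1 : (wedgeAlt (show 1 + 1 + k = k + 2 by omega) (extD θ p) Ω).curryLeft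
        (fieldAt X' p) =
        wedgeAlt (Nat.add_comm 1 k) ((extD θ p).curryLeft (fieldAt X' p)) Ω := by
      rw [curryLeft_wedgeAlt, hΩ, h.pullback_scaledInterior, curryWedgeRight_smul_curryLeft,
        smul_zero, add_zero]
      rfl
    -- The other term of the contraction keeps the factor `θ` and is zero on horizontal vectors.
    have h2 : hrestrict θ p ((wedgeAlt (show 1 + (k + 1) = k + 2 by omega) (θ p) dΩ).curryLeft
        (fieldAt X' p)) = a (π p) • hrestrict θ p dΩ := by
      have h3 : hrestrict θ p (curryWedgeRight (show 1 + (k + 1) = k + 1 + 1 by omega) (θ p) dΩ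
          (fieldAt X' p)) = 0 :=
        curryWedgeRight_comp_eq_zero _ _ _ (hrestrict_self θ p)
      have h4 := curryLeft_wedgeAlt_one (show 1 + (k + 1) = k + 1 + 1 by omega) (θ p) dΩ
        (fieldAt X' p)
      refine (congrArg (hrestrict θ p) h4).trans ?_
      rw [map_sub, h3, hθ, map_smul, sub_zero]
    have h5 : pullback (E := EP) π (automorphicDefect X F η a α) p =
        pullback (E := EP) π (interior X (extD α)) p + a (π p) • dΩ +
          a (π p) • wedgeAlt (Nat.add_comm 1 k) (pullback π η p) Ω -
          wedgeAlt (Nat.add_comm 1 k) (pullback (E := EP) π (interior X F) p) Ω := by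
      have h6 := automorphicDefect_succ_apply h.smooth_X F η h.smooth_a h.contMDiff_inv
        h.a_ne_zero hα (π p)
      rw [pullback_apply, h6]
      have h7 (b : E [⋀^Fin 1]→L[ℝ] ℝ) := wedgeAlt_compContinuousLinearMap (Nat.add_comm 1 k) b
        (scaledInterior X a α (π p)) (tmap EP E π p)
      change pullback (E := EP) π (interior X (extD α)) p + a (π p) • dΩ +
        a (π p) • (wedgeAlt (Nat.add_comm 1 k) (η (π p))
          (scaledInterior X a α (π p))).compContinuousLinearMap (tmap EP E π p) -
        (wedgeAlt (Nat.add_comm 1 k) ((F (π p)).curryLeft (fieldAt X (π p)))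
          (scaledInterior X a α (π p))).compContinuousLinearMap (tmap EP E π p) = _
      rw [h7, h7]
      rfl
    have h8 : (extD (shearLift X a π θ α) p).curryLeft (fieldAt X' p) =
        pullback (E := EP) π (interior X (extD α)) p -
        wedgeAlt (Nat.add_comm 1 k) ((extD θ p).curryLeft (fieldAt X' p)) Ω +
        (wedgeAlt (show 1 + (k + 1) = k + 2 by omega) (θ p) dΩ).curryLeft (fieldAt X' p) := by
      rw [h.extD_shearLift_succ_apply hα, ← hc, ← h1]
      rfl
    rw [h8, h5, map_add, map_sub, h2, hrestrict_wedgeAlt, h.hrestrict_curryLeft_extD_θ,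
      wedgeAlt_sub_left, wedgeAlt_smul_left]
    simp only [map_add, map_sub, map_smul, hrestrict_wedgeAlt]
    abel

end IsShear

end ShearCalculus

/-! ### Automorphic forms and forms on the shear -/

section Correspondence

variable {E : Type*} [NormedAddCommGroup E] [NormedSpace ℝ E] [FiniteDimensional ℝ E]
  {M : Type*} [TopologicalSpace M] [ChartedSpace E M] [IsManifold 𝓘(ℝ, E) ∞ M]
  {EP : Type*} [NormedAddCommGroup EP] [NormedSpace ℝ EP] [FiniteDimensional ℝ EP]
  {P : Type*} [TopologicalSpace P] [ChartedSpace EP P] [IsManifold 𝓘(ℝ, EP) ∞ P]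
  {ES : Type*} [NormedAddCommGroup ES] [NormedSpace ℝ ES]
  {S : Type*} [TopologicalSpace S] [ChartedSpace ES S] [IsManifold 𝓘(ℝ, ES) ∞ S]
  {EL : Type*} [NormedAddCommGroup EL] [NormedSpace ℝ EL]
  {L : Type*} [TopologicalSpace L] [ChartedSpace EL L]
  {X : VField E M} {F : DForm E M 2} {η : DForm E M 1} {a : M → ℝ}
  {π : P → M} {θ : DForm EP P 1} {X' : VField EP P} {πS : P → S}

omit [FiniteDimensional ℝ E] in
theorem IsShear.extD_shearLift_eq (h : IsShear (ES := ES) (EL := EL) L X F η a π θ X' πS) {k : ℕ}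
    {α : DForm E M k} {αS : DForm ES S k} (hαS : SmoothForm αS) (hr : HRelated π θ πS α αS) :
    extD (shearLift X a π θ α) = pullback πS (extD αS) := by
  rw [← h.hRelated_iff_pullback_eq.1 hr]
  ext1 p
  exact extD_pullback (hαS.smoothFormAt _) h.contMDiff_shear_projection.contMDiffAt

theorem IsShear.hRelated_shearD (h : IsShear (ES := ES) (EL := EL) L X F η a π θ X' πS) {k : ℕ}
    {α : DForm E M k} {αS : DForm ES S k} (hα : SmoothForm α) (hαS : SmoothForm αS)
    (hr : HRelated π θ πS α αS) : HRelated π θ πS (shearD X F a α) (extD αS) := by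
  refine hRelated_iff.2 fun p => ?_
  rw [← h.hrestrict_extD_shearLift hα, h.extD_shearLift_eq hαS hr]

/-- The differential of the lift is pulled back from `S`, so its contraction with `X'` is zero;
horizontally that contraction is the defect. -/
theorem IsShear.automorphic_of_hRelated [Nonempty L]
    (h : IsShear (ES := ES) (EL := EL) L X F η a π θ X' πS) {k : ℕ}
    {α : DForm E M k} {αS : DForm ES S k} (hα : SmoothForm α) (hαS : SmoothForm αS)
    (hr : HRelated π θ πS α αS) : Automorphic X F η a α := by
  refine automorphic_iff.2 (h.eq_of_hrestrict_pullback_eq fun p => ?_)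
  rw [← h.hrestrict_curryLeft_extD_shearLift hα, h.extD_shearLift_eq hαS hr, pullback_apply,
    (vanishesOnKer_compContinuousLinearMap _ _).curryLeft_eq_zero (h.tmap_shear_X' p)]
  rfl

omit [FiniteDimensional ℝ EP] [IsManifold 𝓘(ℝ, EP) ∞ P] in
theorem SameLeaf.exists_curve {Z : VField EP P} {p q : P} (h : SameLeaf Z p q) :
    ∃ (c : ℝ → P) (s t : ℝ), ContinuousOn c (Ioo s t) ∧
      (∀ u ∈ Ioo s t, SameLeaf Z (c u) p) ∧ p ∈ c '' Ioo s t ∧ q ∈ c '' Ioo s t := by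
  obtain ⟨c, s, t, hc, hp, hq⟩ := h
  exact ⟨c, s, t, hc.continuousOn, fun u hu => ⟨c, s, t, hc, mem_image_of_mem c hu, hp⟩, hp, hq⟩

theorem IsShear.exists_hRelated [FiniteDimensional ℝ ES]
    (h : IsShear (ES := ES) (EL := EL) L X F η a π θ X' πS) {k : ℕ} {α : DForm E M k}
    (hα : SmoothForm α) (hA : Automorphic X F η a α) :
    ∃ αS : DForm ES S k, SmoothForm αS ∧ HRelated π θ πS α αS := by
  simp only [h.hRelated_iff_pullback_eq]
  refine exists_eq_pullback_of_isSubmersion h.submersion h.surjective (fun p q hpq => ?_)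
    (h.smooth_shearLift hα) (h.vanishesOnKer_shearLift α) fun p => ?_
  · obtain ⟨c, s, t, hc, hcp, hp, hq⟩ := ((h.leaves p q).1 hpq).exists_curve
    exact ⟨c, s, t, hc, fun u hu => (h.leaves _ _).2 (hcp u hu), hp, hq⟩
  -- It remains to see that `X'` annihilates the differential of the lift. Its contraction with `X'`
  -- is again annihilated by `X'`, by alternation, so horizontal vectors suffice, and there it is
  -- the defect.
  · refine VanishesOnKer.of_curryLeft (h.exists_smul_X' p) ?_
    refine h.eq_of_hrestrict_eq (p := p) ?_ (fun _ _ _ => rfl) ?_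
    · cases k with
      | zero => exact vanishesOnKer_degree_zero _ _
      | succ k =>
        refine VanishesOnKer.of_curryLeft (h.exists_smul_X' p) ?_
        ext v
        exact (extD (shearLift X a π θ α) p).map_eq_zero_of_eq
          (Fin.cons (fieldAt X' p) (Fin.cons (fieldAt X' p) v)) (i := 0) (j := 1) rfl (by simp)
    · rw [h.hrestrict_curryLeft_extD_shearLift hα, automorphic_iff.1 hA]
      rfl

/-! ### The differential algebra of automorphic forms -/

omit [FiniteDimensional ℝ EP] [IsManifold 𝓘(ℝ, ES) ∞ S] in
theorem SmoothForm.shearD (h : IsShear (ES := ES) (EL := EL) L X F η a π θ X' πS) {k : ℕ}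
    {α : DForm E M k} (hα : SmoothForm α) : SmoothForm (shearD X F a α) := by
  cases k with
  | zero => exact hα.extD
  | succ k =>
    exact hα.extD.sub ((h.smooth_F.wedge _ (hα.interior h.smooth_X)).fmul h.contMDiff_inv)

-- This uniqueness transfers identities from `S`: two forms on `M` agree once they are related to
-- the same form on `S`.
omit [FiniteDimensional ℝ E] [FiniteDimensional ℝ EP] [IsManifold 𝓘(ℝ, ES) ∞ S] in
theorem IsShear.eq_of_hRelated [Nonempty L]
    (h : IsShear (ES := ES) (EL := EL) L X F η a π θ X' πS) {k : ℕ} {α β : DForm E M k}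
    {αS : DForm ES S k} (hα : HRelated π θ πS α αS) (hβ : HRelated π θ πS β αS) : α = β :=
  h.eq_of_hrestrict_pullback_eq fun p => (hRelated_iff.1 hα p).trans (hRelated_iff.1 hβ p).symm

section Relation

omit [FiniteDimensional ℝ E] [IsManifold 𝓘(ℝ, E) ∞ M] [FiniteDimensional ℝ EP]
  [IsManifold 𝓘(ℝ, EP) ∞ P] [IsManifold 𝓘(ℝ, ES) ∞ S]

theorem hRelated_const (c : ℝ) :
    HRelated π θ πS (ofFun E fun _ : M => c) (ofFun ES fun _ : S => c) := fun _ _ _ => rfl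

theorem HRelated.add {k : ℕ} {α β : DForm E M k} {αS βS : DForm ES S k}
    (hα : HRelated π θ πS α αS) (hβ : HRelated π θ πS β βS) :
    HRelated π θ πS (α + β) (αS + βS) := fun p v hv =>
  congrArg₂ (· + ·) (hα p v hv) (hβ p v hv)

theorem HRelated.smul {k : ℕ} (c : ℝ) {α : DForm E M k} {αS : DForm ES S k}
    (hα : HRelated π θ πS α αS) : HRelated π θ πS (c • α) (c • αS) := fun p v hv =>
  congrArg (c • ·) (hα p v hv)

theorem hRelated_zero (k : ℕ) : HRelated π θ πS (0 : DForm E M k) (0 : DForm ES S k) :=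
  fun _ _ _ => rfl

theorem HRelated.wedge {j k l : ℕ} (h : j + k = l) {α : DForm E M j} {β : DForm E M k}
    {αS : DForm ES S j} {βS : DForm ES S k} (hα : HRelated π θ πS α αS)
    (hβ : HRelated π θ πS β βS) : HRelated π θ πS (wedge h α β) (wedge h αS βS) := by
  rw [hRelated_iff] at *
  intro p
  rw [pullback_wedge, pullback_wedge]
  refine (hrestrict_wedgeAlt θ p h _ _).trans (Eq.trans ?_ (hrestrict_wedgeAlt θ p h _ _).symm)
  rw [hα, hβ]

end Relation

/-- Relatedness respects sums, multiples, wedge products and differentials. Closure therefore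
follows by performing the operation on related forms on `S`, and each identity from the one for `d`
on `S` with `eq_of_hRelated`. -/
theorem IsShear.isDifferentialAlgebra [Nonempty L] [FiniteDimensional ℝ ES]
    (h : IsShear (ES := ES) (EL := EL) L X F η a π θ X' πS) :
    IsDifferentialAlgebra (fun k => {α : DForm E M k | SmoothForm α ∧ Automorphic X F η a α})
      (fun α => shearD X F a α) where
  const_mem c := by
    have h1 := SmoothForm.ofFun (E := E) (M := M) (contMDiff_const (c := c))
    exact ⟨h1, h.automorphic_of_hRelated h1 (SmoothForm.ofFun contMDiff_const) (hRelated_const c)⟩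
  add_mem := fun ⟨hα, hα'⟩ ⟨hβ, hβ'⟩ => by
    obtain ⟨αS, hαS, hr⟩ := h.exists_hRelated hα hα'
    obtain ⟨βS, hβS, hs⟩ := h.exists_hRelated hβ hβ'
    exact ⟨hα.add hβ, h.automorphic_of_hRelated (hα.add hβ) (hαS.add hβS) (hr.add hs)⟩
  smul_mem := fun c _ ⟨hα, hα'⟩ => by
    obtain ⟨αS, hαS, hr⟩ := h.exists_hRelated hα hα'
    exact ⟨hα.const_smul c,
      h.automorphic_of_hRelated (hα.const_smul c) (hαS.const_smul c) (hr.smul c)⟩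
  zero_mem k :=
    ⟨SmoothForm.zero, h.automorphic_of_hRelated SmoothForm.zero SmoothForm.zero (hRelated_zero k)⟩
  wedge_mem := fun e _ _ ⟨hα, hα'⟩ ⟨hβ, hβ'⟩ => by
    obtain ⟨αS, hαS, hr⟩ := h.exists_hRelated hα hα'
    obtain ⟨βS, hβS, hs⟩ := h.exists_hRelated hβ hβ'
    exact ⟨hα.wedge e hβ,
      h.automorphic_of_hRelated (hα.wedge e hβ) (hαS.wedge e hβS) (hr.wedge e hs)⟩
  D_mem := fun ⟨hα, hα'⟩ => by
    obtain ⟨αS, hαS, hr⟩ := h.exists_hRelated hα hα'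
    exact ⟨hα.shearD h,
      h.automorphic_of_hRelated (hα.shearD h) hαS.extD (h.hRelated_shearD hα hαS hr)⟩
  D_add := fun ⟨hα, hα'⟩ ⟨hβ, hβ'⟩ => by
    obtain ⟨αS, hαS, hr⟩ := h.exists_hRelated hα hα'
    obtain ⟨βS, hβS, hs⟩ := h.exists_hRelated hβ hβ'
    have h1 := h.hRelated_shearD (hα.add hβ) (hαS.add hβS) (hr.add hs)
    rw [extD_add hαS hβS] at h1
    exact h.eq_of_hRelated h1 ((h.hRelated_shearD hα hαS hr).add (h.hRelated_shearD hβ hβS hs))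
  D_smul := fun c _ ⟨hα, hα'⟩ => by
    obtain ⟨αS, hαS, hr⟩ := h.exists_hRelated hα hα'
    have h1 := h.hRelated_shearD (hα.const_smul c) (hαS.const_smul c) (hr.smul c)
    rw [extD_smul] at h1
    exact h.eq_of_hRelated h1 ((h.hRelated_shearD hα hαS hr).smul c)
  D_D := fun ⟨hα, hα'⟩ => by
    obtain ⟨αS, hαS, hr⟩ := h.exists_hRelated hα hα'
    have h1 := h.hRelated_shearD (hα.shearD h) hαS.extD (h.hRelated_shearD hα hαS hr)
    rw [extD_extD hαS] at h1
    exact h.eq_of_hRelated h1 (hRelated_zero _)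
  D_wedge := fun e _ _ ⟨hα, hα'⟩ ⟨hβ, hβ'⟩ => by
    obtain ⟨αS, hαS, hr⟩ := h.exists_hRelated hα hα'
    obtain ⟨βS, hβS, hs⟩ := h.exists_hRelated hβ hβ'
    have h1 := h.hRelated_shearD (hα.wedge e hβ) (hαS.wedge e hβS) (hr.wedge e hs)
    rw [extD_wedge e hαS hβS] at h1
    exact h.eq_of_hRelated h1 (((h.hRelated_shearD hα hαS hr).wedge _ hs).add
      ((hr.wedge _ (h.hRelated_shearD hβ hβS hs)).smul _))

end Correspondence

end ShearConstruction

end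

open ShearConstruction in
theorem mainTheorem3
    {E : Type*} [NormedAddCommGroup E] [NormedSpace ℝ E] [FiniteDimensional ℝ E]
    {M : Type*} [TopologicalSpace M] [T2Space M] [SecondCountableTopology M]
    [ChartedSpace E M] [IsManifold 𝓘(ℝ, E) ∞ M]
    {EP : Type*} [NormedAddCommGroup EP] [NormedSpace ℝ EP] [FiniteDimensional ℝ EP]
    {P : Type*} [TopologicalSpace P] [T2Space P] [SecondCountableTopology P]
    [ChartedSpace EP P] [IsManifold 𝓘(ℝ, EP) ∞ P]
    {ES : Type*} [NormedAddCommGroup ES] [NormedSpace ℝ ES] [FiniteDimensional ℝ ES]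
    {S : Type*} [TopologicalSpace S] [T2Space S] [SecondCountableTopology S]
    [ChartedSpace ES S] [IsManifold 𝓘(ℝ, ES) ∞ S]
    {EL : Type*} [NormedAddCommGroup EL] [NormedSpace ℝ EL] (hEL : Module.finrank ℝ EL = 1)
    (L : Type*) [TopologicalSpace L] [ConnectedSpace L]
    [ChartedSpace EL L] [IsManifold 𝓘(ℝ, EL) ∞ L]
    (X : VField E M) (F : DForm E M 2) (η : DForm E M 1) (a : M → ℝ)
    (π : P → M) (θ : DForm EP P 1) (X' : VField EP P) (πS : P → S)
    (hshear : IsShear (ES := ES) (EL := EL) L X F η a π θ X' πS) :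
    (∀ (k : ℕ) (α : DForm E M k), SmoothForm α →
      ((∃ αS : DForm ES S k, SmoothForm αS ∧ HRelated π θ πS α αS) ↔
        Automorphic X F η a α)) ∧
    (∀ (k : ℕ) (α : DForm E M k) (αS : DForm ES S k), SmoothForm α → SmoothForm αS →
      HRelated π θ πS α αS → HRelated π θ πS (shearD X F a α) (extD αS)) ∧
    IsDifferentialAlgebra (fun k => {α : DForm E M k | SmoothForm α ∧ Automorphic X F η a α})
      (fun α => shearD X F a α) :=
  ⟨fun _ _ hα => ⟨fun ⟨_, hαS, hr⟩ => hshear.automorphic_of_hRelated hα hαS hr,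
      hshear.exists_hRelated hα⟩,
    fun _ _ _ hα hαS => hshear.hRelated_shearD hα hαS, hshear.isDifferentialAlgebra⟩
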